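/- Consider $\mathbb Z^2$ as an infinite graph, with edges joining vertices at distance $1$ from each other. For $M,N\ge 1$ let $\mathcal R(M,N)$ be the subgraph induced by the points $(x,y)$ with $y\le x\le y+M-1$ and $-y\le x\le -y+N-1$. For $M,N\ge 1$ with $M$ even, let $\mathcal R^c(M,N)$ be the graph obtained from $\mathcal R(M+1,N)$ by identifying the vertices $(i,i)$ and $(M/2+i,-M/2+i)$ for $0\le i\le\lfloor\frac{N-1}{2}\rfloor$ (multiple edges are replaced by a single edge). For a finite graph $G$, let $\Sigma(G)$ be its independence complex, that is, the simplicial complex of independent sets of $G$, and let $Z_G(u)=\sum_{I} u^{|I|}$, where the sum runs over all independent sets $I$ of $G$, including $\emptyset$. Write $Z^c_{\mathcal R}(M,N)=Z_{\mathcal R^c(M,N)}(-1)$ for the alternating number of independent sets of $\mathcal R^c(M,N)$. **Theorem.** Let $M,N\ge 1$ with $M$ even. Put $m=\lfloor\frac{M+1}{3}\rfloor$ and $n=\lceil N/3\rceil$. - If $N\equiv 1 \pmod 3$, then $\Sigma(\mathcal R^c(M,N))$ is contractible and $Z^c_{\mathcal R}(M,N)=0$. - If $N\not\equiv 1\pmod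 3$ and $M\equiv 0\pmod 3$, then $\Sigma(\mathcal R^c(M,N))$ is homotopy equivalent to a wedge of $2^n$ spheres of dimension $mn-1$, and $Z^c_{\mathcal R}(M,N)=2^n$. - If $N\not\equiv 1\pmod 3$ and $M\equiv 1$ or $2\pmod 3$, then $\Sigma(\mathcal R^c(M,N))$ is homotopy equivalent to a single sphere of dimension $mn-1$, and $Z^c_{\mathcal R}(M,N)=(-1)^n$. -/

import Mathlib

noncomputable section

namespace HardParticle

/-! ### Independent sets of a finite graph -/

/-- The independence complex `Σ(G)`: the simplicial complex on the vertices of `G` whose simplices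
are the independent sets of `G`. (The empty set, of dimension `-1`, is left implicit: an
`AbstractSimplicialComplex` lists its nonempty simplices only.) -/
def independenceComplex {V : Type*} (G : SimpleGraph V) : AbstractSimplicialComplex V where
  faces := {I | I.Nonempty ∧ G.IsIndepSet (I : Set V)}
  isRelLowerSet_faces := fun {_} hI =>
    ⟨hI.1, fun _ hJI hJ => ⟨hJ, Set.Pairwise.mono (Finset.coe_subset.mpr hJI) hI.2⟩⟩
  singleton_mem v := ⟨Finset.singleton_nonempty v, by simp [SimpleGraph.IsIndepSet]⟩

open Classical in
/-- The partition function `Z_G(u) = ∑ u ^ |I|`, the sum being over all independent sets `I` of `G`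
(the empty set included). Its value at `u = -1` is the alternating number of independent sets. -/
def partitionFunction {V : Type*} [Fintype V] (G : SimpleGraph V) (u : ℤ) : ℤ :=
  ∑ I ∈ (Finset.univ : Finset (Finset V)).filter
    (fun I : Finset V => G.IsIndepSet (I : Set V)), u ^ I.card

/-! ### Topology: finite simplicial complexes, spheres and wedges -/

/-- The geometric realization of a simplicial complex on a finite vertex set `V`, in barycentric
coordinates: the union in `ℝ ^ V`, over the simplices `s` of `K`, of the faces of the standard
simplex spanned by `s`, with the subspace topology. -/
def realization {V : Type*} [Fintype V] (K : AbstractSimplicialComplex V) : Set (V → ℝ) :=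
  {x | x ∈ stdSimplex ℝ V ∧ ∃ s ∈ K.faces, ∀ v, v ∉ s → x v = 0}

/-- The unit sphere of dimension `d`, in the Euclidean space of dimension `d + 1`. -/
abbrev Sphere (d : ℕ) : Type :=
  Metric.sphere (0 : EuclideanSpace ℝ (Fin (d + 1))) 1

/-- The point `(1, 0, …, 0)` of the sphere of dimension `d`. -/
def Sphere.base (d : ℕ) : Sphere d :=
  ⟨EuclideanSpace.single 0 1, by simp⟩

/-- The relation that identifies the base point of each space of a family with one extra point. -/
inductive WedgeRel {ι : Type*} {X : ι → Type*} (x₀ : ∀ i, X i) :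
    (Unit ⊕ Σ i, X i) → (Unit ⊕ Σ i, X i) → Prop
  | glue (i : ι) : WedgeRel x₀ (Sum.inl ()) (Sum.inr ⟨i, x₀ i⟩)

/-- The wedge of a family of pointed spaces: the quotient space of their disjoint union (and one
extra point, which matters for the empty family only) in which all base points are identified. -/
abbrev Wedge {ι : Type*} {X : ι → Type*} (x₀ : ∀ i, X i) : Type _ :=
  Quot (WedgeRel x₀)

/-- The wedge of `k` spheres of dimension `d`. -/
abbrev WedgeOfSpheres (k d : ℕ) : Type :=
  Wedge (fun _ : Fin k => Sphere.base d)

/-! ### Rectangles in the square grid, with open and cylindric boundary conditions -/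

/-- The square grid `ℤ²`: two points are adjacent when they are at distance `1`. -/
def squareGrid : SimpleGraph (ℤ × ℤ) where
  Adj p q := |p.1 - q.1| + |p.2 - q.2| = 1
  symm := ⟨fun p q h => by rwa [abs_sub_comm q.1, abs_sub_comm q.2]⟩
  loopless := ⟨fun p h => by simp at h⟩

/-- The points `(x, y)` with `y ≤ x ≤ y + M - 1` and `-y ≤ x ≤ -y + N - 1`. -/
def rectVertices (M N : ℕ) : Set (ℤ × ℤ) :=
  {p | p.2 ≤ p.1 ∧ p.1 ≤ p.2 + M - 1 ∧ -p.2 ≤ p.1 ∧ p.1 ≤ -p.2 + N - 1}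

/-- The rectangle `R(M, N)` with open boundary conditions. -/
def rect (M N : ℕ) : SimpleGraph (rectVertices M N) :=
  squareGrid.induce (rectVertices M N)

theorem rectVertices_finite (M N : ℕ) : (rectVertices M N).Finite := by
  refine (Set.finite_Icc ((-(M + N : ℤ), -(M + N : ℤ)) : ℤ × ℤ) (M + N, M + N)).subset ?_
  rintro ⟨x, y⟩ ⟨h1, h2, h3, h4⟩
  simp only [Set.mem_Icc, Prod.mk_le_mk] at *
  omega

instance (M N : ℕ) : Finite (rectVertices M N) := rectVertices_finite M N

/-- The relation on the vertices of `R(M + 1, N)` that relates `(i, i)` to `(M/2 + i, -M/2 + i)` for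
`0 ≤ i ≤ ⌊(N - 1)/2⌋` (here `M` is even). -/
def cylRel (M N : ℕ) (p q : rectVertices (M + 1) N) : Prop :=
  ∃ i : ℤ, 0 ≤ i ∧ i ≤ ((N : ℤ) - 1) / 2 ∧
    (p : ℤ × ℤ) = (i, i) ∧ (q : ℤ × ℤ) = ((M : ℤ) / 2 + i, -((M : ℤ) / 2) + i)

/-- The vertices of `R(M + 1, N)`, after the identification of `(i, i)` and `(M/2 + i, -M/2 + i)`
for `0 ≤ i ≤ ⌊(N - 1)/2⌋`. -/
abbrev CylVertices (M N : ℕ) : Type :=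
  Quot (cylRel M N)

instance (M N : ℕ) : Fintype (CylVertices M N) := Fintype.ofFinite _

/-- The rectangle `R^c(M, N)` with cylindric boundary conditions (for even `M`): the graph obtained
from `R(M + 1, N)` by identifying vertices as in `CylVertices`. -/
def cylRect (M N : ℕ) : SimpleGraph (CylVertices M N) :=
  SimpleGraph.fromRel fun a b =>
    ∃ p q : rectVertices (M + 1) N, (rect (M + 1) N).Adj p q ∧ Quot.mk _ p = a ∧ Quot.mk _ q = b

end HardParticle

end

/-! ### Graphs with loops and their elementary reductions -/

namespace HardParticle

/-! Everything rests on one move. If every neighbour of a vertex `w` is a neighbour of `u` or of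
`v`, then adding the edge `uv` changes neither the homotopy type of the independence complex nor the
alternating count: a simplex containing both `u` and `v` contains no neighbour of `w`, so it can be
pushed towards `w` (`nonempty_homotopyEquiv_add`), and toggling `w` cancels the lost independent
sets in pairs (`altCount_add`). Taking `u = v` and reading a loop as a deletion gives the fold
lemma: a vertex whose neighbourhood contains that of another vertex may be deleted.

In the coordinates `x - y` (mod `M`) and `x + y`, the graph is a cylinder whose rows are the level
sets of `x + y`. Each vertex of the third row from the end is dominated by the vertex two rows
further, so that row can be deleted. The last two rows then form a separate cycle of length `M`
(`eqv_cylinder_add_three`). Iteration leaves `n` cycles when `N` is not `1` mod `3`; otherwise a row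
of isolated vertices remains and the complex is a cone.

A cycle in turn loses three vertices at the price of an isolated edge (`eqv_cycle_add_three`), down
to an edge, a triangle or a square, the square folding to an edge. Hence the graph reduces to `m *
n` disjoint cliques, all edges except for one triangle per cycle when `3` divides `M`.

The independence complex of a disjoint union of cliques is a join of finite discrete sets. Marking
one vertex in each clique exhibits it as a union of cross-polytope boundaries, one for each choice
of an unmarked vertex in every clique; a flow towards a point in the marked simplex turns this union
into a wedge of spheres (`nonempty_homotopyEquiv_cliques`). -/

/-- A finite graph in which loops are allowed. A vertex with a loop belongs to no independent set,
so that adding a loop amounts to deleting the vertex. -/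
structure LoopGraph where
  V : Type
  [fin : Fintype V]
  rel : V → V → Prop

attribute [instance] LoopGraph.fin

namespace LoopGraph

/-- The realization of the independence complex of a graph with loops. -/
def realization (A : LoopGraph) : Set (A.V → ℝ) :=
  {x | x ∈ stdSimplex ℝ A.V ∧ ∀ a b, A.rel a b → x a * x b = 0}

open Classical in
/-- The independent sets of a graph with loops. -/
noncomputable def indepSets (A : LoopGraph) : Finset (Finset A.V) :=
  Finset.univ.filter fun I => ∀ a ∈ I, ∀ b ∈ I, ¬ A.rel a b

/-- The alternating number of independent sets. -/
noncomputable def altCount (A : LoopGraph) : ℤ := ∑ I ∈ A.indepSets, (-1) ^ I.card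

theorem mem_indepSets {A : LoopGraph} {I : Finset A.V} :
    I ∈ A.indepSets ↔ ∀ a ∈ I, ∀ b ∈ I, ¬ A.rel a b := by
  simp [indepSets]

/-- The disjoint union of two graphs. -/
abbrev sum (A B : LoopGraph) : LoopGraph := ⟨A.V ⊕ B.V, Sum.LiftRel A.rel B.rel⟩

/-- The equivalence relation generated by discarding vertices with loops and by adding a loop or an
edge `uv` when some other vertex has all of its neighbours among those of `u` and `v`. -/
inductive Eqv : LoopGraph → LoopGraph → Prop
  | refl (A) : Eqv A A
  | symm {A B} : Eqv A B → Eqv B A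
  | trans {A B C} : Eqv A B → Eqv B C → Eqv A C
  | embed {A B : LoopGraph} (f : B.V → A.V) (hf : Function.Injective f)
      (hrel : ∀ a b, B.rel a b ↔ A.rel (f a) (f b))
      (hl : ∀ a, a ∉ Set.range f → A.rel a a) : Eqv A B
  | add {V : Type} [Fintype V] {r r' : V → V → Prop} (u v w : V) (hu : w ≠ u) (hv : w ≠ v)
      (hw : ¬ r w w) (h : ∀ c, r w c ∨ r c w → r u c ∨ r c u ∨ r v c ∨ r c v)
      (hr : ∀ a b, r' a b ∨ r' b a ↔ r a b ∨ r b a ∨ (a = u ∧ b = v) ∨ (a = v ∧ b = u)) :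
      Eqv ⟨V, r⟩ ⟨V, r'⟩

theorem Eqv.add_of_symm {V : Type} [Fintype V] {r r' : V → V → Prop} (u v w : V) (hu : w ≠ u)
    (hv : w ≠ v) (hw : ¬ r w w) (hs : ∀ a b, r a b → r b a) (h : ∀ c, r w c → r u c ∨ r v c)
    (hr : ∀ a b, r' a b ↔ r a b ∨ (a = u ∧ b = v) ∨ (a = v ∧ b = u)) :
    Eqv ⟨V, r⟩ ⟨V, r'⟩ := by
  refine .add u v w hu hv hw ?_ fun a b => ?_
  · rintro c (hc | hc)
    · have := h c hc; tauto
    · have := h c (hs _ _ hc); tauto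
  · rw [hr, hr]
    tauto

theorem Eqv.sum_right {A A' : LoopGraph} (h : Eqv A A') (B : LoopGraph) :
    Eqv (A.sum B) (A'.sum B) := by
  induction h with
  | refl A => exact .refl _
  | symm _ ih => exact ih.symm
  | trans _ _ ih₁ ih₂ => exact ih₁.trans ih₂
  | embed f hf hrel hl =>
    refine .embed (Sum.map f id) (hf.sumMap Function.injective_id) ?_ ?_
    · rintro (a | a) (b | b) <;> simp [hrel]
    · rintro (a | a) ha
      · exact .inl (hl a fun ⟨b, hb⟩ => ha ⟨.inl b, congrArg Sum.inl hb⟩)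
      · exact absurd ⟨.inr a, rfl⟩ ha
  | add u v w hu hv hw h hr =>
    refine .add (.inl u) (.inl v) (.inl w) (by simpa using hu) (by simpa using hv)
      (by simpa using hw) ?_ ?_
    · rintro (c | c)
      · simpa using h c
      · simp
    · rintro (a | a) (b | b)
      · simpa using hr a b
      all_goals simp

theorem Eqv.sum_comm (A B : LoopGraph) : Eqv (A.sum B) (B.sum A) := by
  refine .embed Sum.swap Sum.swap_leftInverse.injective ?_ fun a ha =>
    absurd ⟨Sum.swap a, Sum.swap_swap a⟩ ha
  rintro (a | a) (b | b) <;> simp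

theorem Eqv.sum {A A' B B' : LoopGraph} (h : Eqv A A') (h' : Eqv B B') :
    Eqv (A.sum B) (A'.sum B') :=
  (h.sum_right B).trans <| (Eqv.sum_comm _ _).trans <| (h'.sum_right A').trans (Eqv.sum_comm _ _)

/-- Vertices may be deleted simultaneously if each of them is dominated by a vertex that is kept. -/
theorem Eqv.addLoops {V : Type} [Fintype V] {r : V → V → Prop} (S : Finset V) (d : V → V)
    (hd : ∀ u ∈ S, d u ∉ S) (hdd : ∀ u ∈ S, ¬ r (d u) (d u))
    (h : ∀ u ∈ S, ∀ c, r (d u) c ∨ r c (d u) → r u c ∨ r c u) :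
    Eqv ⟨V, r⟩ ⟨V, fun a b => r a b ∨ (a = b ∧ a ∈ S)⟩ := by
  classical
  suffices H : ∀ T ⊆ S, Eqv ⟨V, r⟩ ⟨V, fun a b => r a b ∨ (a = b ∧ a ∈ T)⟩ from H S subset_rfl
  intro T
  induction T using Finset.induction_on with
  | empty => intro _; simpa using Eqv.refl _
  | insert u T hu ih =>
    intro hT
    have huS : u ∈ S := hT (Finset.mem_insert_self u T)
    have hTS : T ⊆ S := (Finset.subset_insert u T).trans hT
    have hdT : d u ∉ T := fun hh => hd u huS (hTS hh)
    -- A loop at `u` is an edge from `u` to itself, so the move applies with both ends equal to `u`.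
    -- The dominating vertex `d u` lies outside `S` and therefore stays free of added loops
    -- throughout the induction.
    refine (ih hTS).trans (.add u u (d u) ?_ ?_ ?_ ?_ ?_)
    · exact fun h' => hd u huS (h'.symm ▸ huS)
    · exact fun h' => hd u huS (h'.symm ▸ huS)
    · simpa [hdT] using hdd u huS
    · rintro c ((h' | h') | (h' | h'))
      · have := h u huS c (.inl h'); tauto
      · exact absurd h'.2 hdT
      · have := h u huS c (.inr h'); tauto
      · exact absurd (h'.1 ▸ h'.2) hdT
    · intro a b
      simp only [Finset.mem_insert]
      grind

/-! ### Invariance of the alternating number of independent sets -/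

theorem altCount_embed {A B : LoopGraph} (f : B.V → A.V) (hf : Function.Injective f)
    (hrel : ∀ a b, B.rel a b ↔ A.rel (f a) (f b)) (hl : ∀ a, a ∉ Set.range f → A.rel a a) :
    A.altCount = B.altCount := by
  classical
  symm
  refine Finset.sum_bij (fun I _ => I.map ⟨f, hf⟩) ?_ ?_ ?_ ?_
  · intro I hI
    simp only [mem_indepSets] at hI ⊢
    intro a ha b hb
    simp only [Finset.mem_map, Function.Embedding.coeFn_mk] at ha hb
    obtain ⟨a, ha, rfl⟩ := ha
    obtain ⟨b, hb, rfl⟩ := hb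
    rw [← hrel]
    exact hI a ha b hb
  · intro I _ J _ h
    exact Finset.map_injective _ h
  · intro I hI
    rw [mem_indepSets] at hI
    refine ⟨I.preimage f hf.injOn, ?_, ?_⟩
    · rw [mem_indepSets]
      intro a ha b hb
      rw [hrel]
      exact hI _ (Finset.mem_preimage.mp ha) _ (Finset.mem_preimage.mp hb)
    · ext a
      simp only [Finset.mem_map, Finset.mem_preimage, Function.Embedding.coeFn_mk]
      constructor
      · rintro ⟨b, hb, rfl⟩; exact hb
      · intro ha
        by_contra hcon
        exact hI a ha a ha (hl a fun ⟨b, hb⟩ => hcon ⟨b, hb ▸ ha, hb⟩)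
  · intro I _
    simp

/-- Toggling `w` is an involution without fixed points that changes the parity of the cardinality.
-/
theorem sum_neg_one_pow_card_eq_zero {V : Type} [DecidableEq V] (F : Finset (Finset V)) (w : V)
    (h : ∀ I ∈ F, symmDiff I {w} ∈ F) : ∑ I ∈ F, (-1 : ℤ) ^ I.card = 0 := by
  refine Finset.sum_involution (fun I _ => symmDiff I {w}) ?_ ?_ h ?_
  · intro I _
    by_cases hw : w ∈ I
    · have h1 : symmDiff I {w} = I.erase w := by
        ext a; simp only [Finset.mem_symmDiff, Finset.mem_singleton, Finset.mem_erase]; grind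
      have h2 := Finset.card_erase_add_one hw
      rw [h1, ← h2, pow_succ]; ring
    · have h1 : symmDiff I {w} = insert w I := by
        ext a; simp only [Finset.mem_symmDiff, Finset.mem_singleton, Finset.mem_insert]; grind
      rw [h1, Finset.card_insert_of_notMem hw, pow_succ]; ring
  · intro I _ _ hI
    have : w ∈ symmDiff I {w} ↔ w ∈ I := by rw [hI]
    simp [Finset.mem_symmDiff] at this
  · intro I _
    simp

/-- The independent sets destroyed by the new edge are those containing `u` and `v`. They avoid all
neighbours of `w`, so toggling `w` preserves this family and its signed count is zero. -/
theorem altCount_add {V : Type} [Fintype V] {r r' : V → V → Prop} (u v w : V) (hu : w ≠ u)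
    (hv : w ≠ v) (hw : ¬ r w w) (h : ∀ c, r w c ∨ r c w → r u c ∨ r c u ∨ r v c ∨ r c v)
    (hr : ∀ a b, r' a b ∨ r' b a ↔ r a b ∨ r b a ∨ (a = u ∧ b = v) ∨ (a = v ∧ b = u)) :
    altCount ⟨V, r⟩ = altCount ⟨V, r'⟩ := by
  classical
  have hsub : indepSets ⟨V, r'⟩ ⊆ indepSets ⟨V, r⟩ := by
    intro I hI
    have hI := mem_indepSets.1 hI
    refine mem_indepSets.2 fun a ha b hb hab => ?_
    rcases (hr a b).2 (.inl hab) with h' | h'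
    · exact hI a ha b hb h'
    · exact hI b hb a ha h'
  have key : ∀ I : Finset V, I ∈ indepSets ⟨V, r⟩ \ indepSets ⟨V, r'⟩ ↔
      (∀ a ∈ I, ∀ b ∈ I, ¬ r a b) ∧ u ∈ I ∧ v ∈ I := by
    intro I
    refine Finset.mem_sdiff.trans ((and_congr mem_indepSets mem_indepSets.not).trans ?_)
    refine and_congr_right fun hI => ⟨fun h' => ?_, fun h' hc => ?_⟩
    · push Not at h'
      obtain ⟨a, ha, b, hb, hab⟩ := h'
      have h1 := hI a ha b hb
      have h2 := hI b hb a ha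
      rcases (hr a b).1 (.inl hab) with h' | h' | ⟨rfl, rfl⟩ | ⟨rfl, rfl⟩ <;> tauto
    · have h1 := hc u h'.1 v h'.2
      have h2 := hc v h'.2 u h'.1
      rcases (hr u v).2 (.inr (.inr (.inl ⟨rfl, rfl⟩))) with h' | h' <;> tauto
  rw [altCount, altCount, ← Finset.sum_sdiff hsub, add_eq_right]
  refine sum_neg_one_pow_card_eq_zero _ w fun I hI => ?_
  rw [key] at hI ⊢
  obtain ⟨hI, huI, hvI⟩ := hI
  have hc : ∀ c ∈ I, ¬ (r w c ∨ r c w) := by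
    intro c hcI hcw
    have h1 := hI c hcI u huI
    have h2 := hI c hcI v hvI
    have h3 := hI u huI c hcI
    have h4 := hI v hvI c hcI
    have := h c hcw
    tauto
  simp only [Finset.mem_symmDiff, Finset.mem_singleton]
  refine ⟨?_, by tauto, by tauto⟩
  rintro a (⟨ha, -⟩ | ⟨rfl, -⟩) b (⟨hb, -⟩ | ⟨rfl, -⟩)
  · exact hI a ha b hb
  · have := hc a ha; tauto
  · have := hc b hb; tauto
  · exact hw

theorem Eqv.altCount_eq {A B : LoopGraph} (h : Eqv A B) : A.altCount = B.altCount := by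
  induction h with
  | refl A => rfl
  | symm _ ih => exact ih.symm
  | trans _ _ ih₁ ih₂ => exact ih₁.trans ih₂
  | embed f hf hrel hl => exact altCount_embed f hf hrel hl
  | add u v w hu hv hw h hr => exact altCount_add u v w hu hv hw h hr

theorem altCount_sum (A B : LoopGraph) : (A.sum B).altCount = A.altCount * B.altCount := by
  classical
  rw [altCount, altCount, altCount, Finset.sum_mul_sum, ← Finset.sum_product']
  refine (Finset.sum_bij (fun p _ => p.1.disjSum p.2) ?_ ?_ ?_ ?_).symm
  · rintro ⟨I, J⟩ h
    simp only [Finset.mem_product, mem_indepSets] at h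
    refine mem_indepSets.2 ?_
    rintro (a | a) ha (b | b) hb <;> simp only [Finset.inl_mem_disjSum, Finset.inr_mem_disjSum]
      at ha hb <;> simp only [Sum.liftRel_inl_inl, Sum.liftRel_inr_inr,
      Sum.not_liftRel_inl_inr, Sum.not_liftRel_inr_inl, not_false_eq_true]
    · exact h.1 a ha b hb
    · exact h.2 a ha b hb
  · rintro ⟨I, J⟩ _ ⟨I', J'⟩ _ h
    have h1 := congrArg Finset.toLeft h
    have h2 := congrArg Finset.toRight h
    simp only [Finset.toLeft_disjSum, Finset.toRight_disjSum] at h1 h2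
    rw [h1, h2]
  · intro I hI
    have hI := mem_indepSets.1 hI
    refine ⟨(I.toLeft, I.toRight), ?_, Finset.toLeft_disjSum_toRight⟩
    refine Finset.mem_product.2 ⟨mem_indepSets.2 fun a ha b hb hab => ?_,
      mem_indepSets.2 fun a ha b hb hab => ?_⟩
    · exact hI _ (Finset.mem_toLeft.1 ha) _ (Finset.mem_toLeft.1 hb) (.inl hab)
    · exact hI _ (Finset.mem_toRight.1 ha) _ (Finset.mem_toRight.1 hb) (.inr hab)
  · rintro ⟨I, J⟩ _
    exact (pow_add _ _ _).symm.trans (congrArg _ (Finset.card_disjSum I J).symm)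

/-! ### Invariance of the homotopy type -/

/-- The time-one map and the inclusion are mutually inverse up to homotopy. Points of `T` need to be
fixed at time one only. -/
theorem nonempty_homotopyEquiv_of_deformation {E : Type*} [TopologicalSpace E] {S T : Set E}
    (hTS : T ⊆ S) (D : ℝ → E → E) (hD : Continuous fun p : ℝ × E => D p.1 p.2)
    (h0 : ∀ x ∈ S, D 0 x = x) (hS : ∀ t ∈ Set.Icc (0 : ℝ) 1, ∀ x ∈ S, D t x ∈ S)
    (h1 : ∀ x ∈ S, D 1 x ∈ T) (hT : ∀ x ∈ T, D 1 x = x) :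
    Nonempty (ContinuousMap.HomotopyEquiv S T) := by
  have hc : Continuous (D 1) := hD.comp (Continuous.prodMk continuous_const continuous_id)
  let f : C(S, T) := ⟨fun x => ⟨D 1 x, h1 x x.2⟩, by fun_prop⟩
  let g : C(T, S) := ⟨fun x => ⟨x, hTS x.2⟩, by fun_prop⟩
  refine ⟨⟨f, g, ?_, ?_⟩⟩
  · refine (ContinuousMap.Homotopic.symm ⟨⟨⟨fun p => ⟨D p.1 p.2, hS _ p.1.2 _ p.2.2⟩, ?_⟩, ?_, ?_⟩⟩)
    · refine Continuous.subtype_mk (hD.comp (f := fun p : unitInterval × S =>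
        ((p.1 : ℝ), (p.2 : E))) (by fun_prop)) _
    · intro x; exact Subtype.ext (h0 x x.2)
    · intro x; rfl
  · have : f.comp g = ContinuousMap.id T := by
      ext x; exact hT x x.2
    rw [this]

theorem nonempty_homotopyEquiv_embed {A B : LoopGraph} (f : B.V → A.V) (hf : Function.Injective f)
    (hrel : ∀ a b, B.rel a b ↔ A.rel (f a) (f b)) (hl : ∀ a, a ∉ Set.range f → A.rel a a) :
    Nonempty (ContinuousMap.HomotopyEquiv A.realization B.realization) := by
  classical
  -- A loop at `a` imposes `x a * x a = 0`.
  have hz : ∀ x ∈ A.realization, ∀ a, a ∉ Set.range f → x a = 0 := fun x hx a ha => by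
    simpa using hx.2 a a (hl a ha)
  have hsum : ∀ x : A.V → ℝ, (∀ a, a ∉ Set.range f → x a = 0) →
      ∑ b, x (f b) = ∑ a, x a := by
    intro x hx
    rw [← Finset.sum_image (s := Finset.univ) (g := f) (f := x) (fun _ _ _ _ h => hf h)]
    refine Finset.sum_subset (Finset.subset_univ _) fun a _ ha => hx a ?_
    simpa using ha
  have hext : ∀ (y : B.V → ℝ) b, Function.extend f y 0 (f b) = y b := fun y b =>
    hf.extend_apply _ _ _
  have hext' : ∀ (y : B.V → ℝ) a, a ∉ Set.range f → Function.extend f y 0 a = 0 := fun y a ha =>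
    Function.extend_apply' _ _ _ ha
  have hcont : Continuous fun y : B.V → ℝ => Function.extend f y 0 := by
    refine continuous_pi fun a => ?_
    by_cases ha : a ∈ Set.range f
    · obtain ⟨b, rfl⟩ := ha
      simp only [hext]; fun_prop
    · simp only [hext' _ a ha]; fun_prop
  have hmem : ∀ y ∈ B.realization, Function.extend f y 0 ∈ A.realization := by
    rintro y ⟨⟨hy0, hy1⟩, hy⟩
    refine ⟨⟨fun a => ?_, ?_⟩, fun a b hab => ?_⟩
    · by_cases ha : a ∈ Set.range f
      · obtain ⟨b, rfl⟩ := ha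
        simpa only [hext] using hy0 b
      · simp only [hext' _ a ha]; exact le_rfl
    · rw [← hsum _ (hext' y)]
      simpa only [hext] using hy1
    · by_cases ha : a ∈ Set.range f
      · by_cases hb : b ∈ Set.range f
        · obtain ⟨a, rfl⟩ := ha
          obtain ⟨b, rfl⟩ := hb
          simpa only [hext] using hy a b ((hrel a b).2 hab)
        · rw [hext' _ b hb, mul_zero]
      · rw [hext' _ a ha, zero_mul]
  have hcont' : Continuous fun (x : A.V → ℝ) (b : B.V) => x (f b) :=
    continuous_pi fun b => continuous_apply (f b)
  let e : A.realization ≃ₜ B.realization :=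
    { toFun := fun x => ⟨fun b => x.1 (f b), ⟨fun b => x.2.1.1 _, (hsum x.1 (hz x.1 x.2)).trans
          x.2.1.2⟩, fun a b hab => x.2.2 _ _ ((hrel a b).1 hab)⟩
      invFun := fun y => ⟨Function.extend f y.1 0, hmem y.1 y.2⟩
      left_inv := fun x => by
        ext a
        by_cases ha : a ∈ Set.range f
        · obtain ⟨b, rfl⟩ := ha
          exact hext _ b
        · exact (hext' _ a ha).trans (hz x.1 x.2 a ha).symm
      right_inv := fun y => by
        ext b
        exact hext _ b
      continuous_toFun := Continuous.subtype_mk (hcont'.comp continuous_subtype_val) _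
      continuous_invFun := Continuous.subtype_mk (hcont.comp continuous_subtype_val) _ }
  exact ⟨e.toHomotopyEquiv⟩

/-- Move the mass `min (x u) (x v)` away from both `u` and `v` onto `w`. If this mass is positive,
no neighbour of `w` carries weight, so `w` may join the support; at time one `u` or `v` has lost all
its weight, as the new edge requires. -/
theorem nonempty_homotopyEquiv_add {V : Type} [Fintype V] {r r' : V → V → Prop} (u v w : V)
    (hu : w ≠ u) (hv : w ≠ v) (hw : ¬ r w w)
    (h : ∀ c, r w c ∨ r c w → r u c ∨ r c u ∨ r v c ∨ r c v)
    (hr : ∀ a b, r' a b ∨ r' b a ↔ r a b ∨ r b a ∨ (a = u ∧ b = v) ∨ (a = v ∧ b = u)) :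
    Nonempty (ContinuousMap.HomotopyEquiv (realization ⟨V, r⟩) (realization ⟨V, r'⟩)) := by
  classical
  -- When `u = v` the mass must leave this single vertex once, not twice.
  let δ : ℝ := if u = v then 0 else 1
  let s : (V → ℝ) → ℝ := fun x => min (x u) (x v)
  let D : ℝ → (V → ℝ) → V → ℝ := fun t x => x + (t * s x) •
    ((Pi.single w 1 - Pi.single u 1) + δ • (Pi.single w 1 - Pi.single v 1))
  have hs : Continuous s := by fun_prop
  have hδ : 0 ≤ δ := by simp only [δ]; split_ifs <;> norm_num
  have hDw : ∀ t x, D t x w = x w + t * s x * (1 + δ) := by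
    intro t x; simp [D, hu, hv]; ring
  have hDu : ∀ t x, D t x u = x u - t * s x := by
    intro t x
    by_cases huv : u = v
    · simp [D, δ, huv, hv.symm]; ring
    · simp [D, hu.symm, δ, huv]; ring
  have hDv : ∀ t x, D t x v = x v - t * s x := by
    intro t x
    by_cases huv : u = v
    · simp [D, δ, huv, hv.symm]; ring
    · simp [D, hv.symm, δ, huv, Ne.symm huv]; ring
  have hDa : ∀ t x a, a ≠ w → a ≠ u → a ≠ v → D t x a = x a := by
    intro t x a h1 h2 h3; simp [D, h1, h2, h3]
  have hDsum : ∀ t x, ∑ a, D t x a = ∑ a, x a := by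
    intro t x
    simp [D, Finset.sum_add_distrib, ← Finset.mul_sum, Finset.sum_sub_distrib]
  have hs0 : ∀ x ∈ stdSimplex ℝ V, 0 ≤ s x := fun x hx => le_min (hx.1 u) (hx.1 v)
  have hstd : ∀ t ∈ Set.Icc (0 : ℝ) 1, ∀ x ∈ stdSimplex ℝ V, D t x ∈ stdSimplex ℝ V := by
    intro t ht x hx
    refine ⟨fun a => ?_, (hDsum t x).trans hx.2⟩
    have h0 := hs0 x hx
    have hts : t * s x ≤ s x := mul_le_of_le_one_left h0 ht.2
    by_cases h1 : a = w
    · subst h1; rw [hDw]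
      have := hx.1 a
      have := ht.1
      positivity
    by_cases h2 : a = u
    · subst h2; rw [hDu]; linarith [min_le_left (x a) (x v)]
    by_cases h3 : a = v
    · subst h3; rw [hDv]; linarith [min_le_right (x u) (x a)]
    · rw [hDa t x a h1 h2 h3]; exact hx.1 a
  have hsupp : ∀ t x a, x a = 0 → a ≠ w → 0 ≤ s x → (∀ a, 0 ≤ x a) → D t x a = 0 := by
    intro t x a hxa haw hsx hx
    by_cases h2 : a = u
    · subst h2
      have : s x = 0 := le_antisymm (hxa ▸ min_le_left _ _) hsx
      rw [hDu, this, hxa]; ring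
    by_cases h3 : a = v
    · subst h3
      have : s x = 0 := le_antisymm (hxa ▸ min_le_right _ _) hsx
      rw [hDv, this, hxa]; ring
    rw [hDa t x a haw h2 h3, hxa]
  have hfix : ∀ t x, s x = 0 → D t x = x := by
    intro t x hx; simp [D, hx]
  have hS : ∀ t ∈ Set.Icc (0 : ℝ) 1, ∀ x ∈ realization ⟨V, r⟩, D t x ∈ realization ⟨V, r⟩ := by
    rintro t ht x ⟨hx, hxr⟩
    refine ⟨hstd t ht x hx, fun a b hab => ?_⟩
    have h0 := hs0 x hx
    change r a b at hab
    have hxr' : ∀ a b, r a b → x a * x b = 0 := hxr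
    by_cases hsx : s x = 0
    · rw [hfix t x hsx]; exact hxr a b hab
    have hxu : x u ≠ 0 := fun h' => hsx (le_antisymm (h' ▸ min_le_left _ _) h0)
    have hxv : x v ≠ 0 := fun h' => hsx (le_antisymm (h' ▸ min_le_right _ _) h0)
    have hc : ∀ c, r w c ∨ r c w → x c = 0 := by
      intro c hcw
      rcases h c hcw with h' | h' | h' | h' <;> have := hxr' _ _ h' <;> simp_all
    by_cases haw : a = w
    · subst haw
      have hb : b ≠ a := by rintro rfl; exact hw hab
      rw [hsupp t x b (hc b (.inl hab)) hb h0 hx.1, mul_zero]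
    by_cases hbw : b = w
    · subst hbw
      rw [hsupp t x a (hc a (.inr hab)) haw h0 hx.1, zero_mul]
    rcases mul_eq_zero.1 (hxr a b hab) with h' | h'
    · rw [hsupp t x a h' haw h0 hx.1, zero_mul]
    · rw [hsupp t x b h' hbw h0 hx.1, mul_zero]
  refine nonempty_homotopyEquiv_of_deformation (D := D) ?_ ?_ ?_ hS ?_ ?_
  · rintro x ⟨hx, hxr⟩
    refine ⟨hx, fun a b hab => ?_⟩
    rcases (hr a b).2 (.inl hab) with h' | h'
    · exact hxr a b h'
    · rw [mul_comm]; exact hxr b a h'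
  · fun_prop
  · intro x _; simp [D]
  · intro x hx
    have h1 := hS 1 (by simp) x hx
    refine ⟨h1.1, fun a b hab => ?_⟩
    have huv : D 1 x u * D 1 x v = 0 := by
      rw [hDu, hDv, one_mul]
      rcases min_choice (x u) (x v) with h' | h' <;> simp [s, h']
    rcases (hr a b).1 (.inl hab) with h' | h' | ⟨rfl, rfl⟩ | ⟨rfl, rfl⟩
    · exact h1.2 a b h'
    · rw [mul_comm]; exact h1.2 b a h'
    · exact huv
    · rw [mul_comm]; exact huv
  · rintro x ⟨hx, hxr⟩
    refine hfix 1 x ?_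
    have huv : x u * x v = 0 := by
      rcases (hr u v).2 (.inr (.inr (.inl ⟨rfl, rfl⟩))) with h' | h'
      · exact hxr u v h'
      · rw [mul_comm]; exact hxr v u h'
    have hxu := hx.1 u
    have hxv := hx.1 v
    rcases mul_eq_zero.1 huv with h' | h' <;> simp [s, h', hxu, hxv]

theorem Eqv.nonempty_homotopyEquiv {A B : LoopGraph} (h : Eqv A B) :
    Nonempty (ContinuousMap.HomotopyEquiv A.realization B.realization) := by
  induction h with
  | refl A => exact ⟨.refl _⟩
  | symm _ ih => exact ih.map .symm
  | trans _ _ ih₁ ih₂ => exact ⟨ih₁.some.trans ih₂.some⟩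
  | embed f hf hrel hl => exact nonempty_homotopyEquiv_embed f hf hrel hl
  | add u v w hu hv hw h hr => exact nonempty_homotopyEquiv_add u v w hu hv hw h hr

/-! ### Graphs with an isolated vertex -/

/-- The complex is a cone with apex `w`: straight segments to the apex stay inside it. -/
theorem contractibleSpace_of_isolated {A : LoopGraph} (w : A.V)
    (hw : ∀ c, ¬ A.rel w c ∧ ¬ A.rel c w) : ContractibleSpace A.realization := by
  classical
  have hmem : (Pi.single w 1 : A.V → ℝ) ∈ A.realization := by
    refine ⟨single_mem_stdSimplex ℝ w, fun a b hab => ?_⟩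
    have ha : a ≠ w := by rintro rfl; exact (hw b).1 hab
    simp [ha]
  have : Nonempty (ContinuousMap.HomotopyEquiv A.realization
      ({Pi.single w 1} : Set (A.V → ℝ))) := by
    refine nonempty_homotopyEquiv_of_deformation (by simpa using hmem)
      (fun t x => (1 - t) • x + t • Pi.single w 1) (by fun_prop) (by simp) ?_ (by simp) (by simp)
    rintro t ⟨ht0, ht1⟩ x hx
    refine ⟨convex_stdSimplex ℝ A.V hx.1 hmem.1 (by linarith) ht0 (by ring), fun a b hab => ?_⟩
    have ha : a ≠ w := by rintro rfl; exact (hw b).1 hab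
    have hb : b ≠ w := by rintro rfl; exact (hw a).2 hab
    rcases mul_eq_zero.1 (hx.2 a b hab) with h' | h' <;> simp [ha, hb, h']
  obtain ⟨e⟩ := this
  exact e.contractibleSpace

theorem altCount_eq_zero_of_isolated {A : LoopGraph} (w : A.V)
    (hw : ∀ c, ¬ A.rel w c ∧ ¬ A.rel c w) : A.altCount = 0 := by
  classical
  refine sum_neg_one_pow_card_eq_zero _ w fun I hI => ?_
  rw [mem_indepSets] at hI ⊢
  simp only [Finset.mem_symmDiff, Finset.mem_singleton]
  rintro a (⟨ha, -⟩ | ⟨rfl, -⟩) b (⟨hb, -⟩ | ⟨rfl, -⟩)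
  · exact hI a ha b hb
  · exact (hw a).2
  · exact (hw b).1
  · exact (hw _).1

/-! ### Simple graphs -/

/-- A simple graph, as a graph with loops. -/
abbrev ofSimpleGraph {V : Type} [Fintype V] (G : SimpleGraph V) : LoopGraph := ⟨V, G.Adj⟩

/-- The independence complex is a flag complex: a point lies in it exactly when its support is
independent, a condition on pairs of coordinates. -/
theorem realization_independenceComplex {V : Type} [Fintype V] (G : SimpleGraph V) :
    HardParticle.realization (independenceComplex G) = (ofSimpleGraph G).realization := by
  classical
  ext x
  refine and_congr_right fun hx => ⟨?_, fun h => ?_⟩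
  · rintro ⟨s, ⟨-, hs⟩, h⟩ a b hab
    by_contra hne
    have ha : a ∈ s := by by_contra ha; exact hne (by simp [h a ha])
    have hb : b ∈ s := by by_contra hb; exact hne (by simp [h b hb])
    exact hs ha hb hab.ne hab
  · refine ⟨Finset.univ.filter fun v => x v ≠ 0, ⟨?_, ?_⟩, by simp⟩
    · by_contra hne
      rw [Finset.not_nonempty_iff_eq_empty, Finset.filter_eq_empty_iff] at hne
      have h1 := hx.2
      simp only [Finset.mem_univ, not_not, true_imp_iff] at hne
      simp [hne] at h1
    · intro a ha b hb _ hab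
      have := h a b hab
      simp_all

theorem partitionFunction_neg_one {V : Type} [Fintype V] (G : SimpleGraph V) :
    partitionFunction G (-1) = (ofSimpleGraph G).altCount := by
  classical
  refine Finset.sum_congr ?_ fun _ _ => rfl
  ext I
  refine (Finset.mem_filter_univ I).trans (Iff.trans ?_ mem_indepSets.symm)
  refine ⟨fun h a ha b hb hab => h ha hb hab.ne hab, fun h a ha b hb _ hab => h a ha b hb hab⟩

/-! ### Disjoint unions of cliques -/

/-- A disjoint union of cliques, the `i`-th of which has `s i + 1` vertices. -/
abbrev cliques {ι : Type} [Fintype ι] (s : ι → ℕ) : LoopGraph :=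
  ⟨Σ i, Option (Fin (s i)), fun a b => a.1 = b.1 ∧ a ≠ b⟩

/-- A graph is of clique type `(m, p)` when it can be reduced to a disjoint union of `m` cliques,
with orders `s i + 1` such that `p` is the product of the `s i`. -/
def HasCliqueType (A : LoopGraph) (m p : ℕ) : Prop :=
  A.altCount = (-1) ^ m * p ∧ ∃ (ι : Type) (_ : Fintype ι) (s : ι → ℕ),
    Fintype.card ι = m ∧ ∏ i, s i = p ∧ Eqv A (cliques s)

theorem HasCliqueType.of_eqv {A B : LoopGraph} {m p : ℕ} (hB : B.HasCliqueType m p)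
    (h : Eqv A B) : A.HasCliqueType m p := by
  obtain ⟨h0, ι, _, s, h1, h2, h3⟩ := hB
  exact ⟨h.altCount_eq.trans h0, ι, _, s, h1, h2, h.trans h3⟩

theorem cliques_sum {ι κ : Type} [Fintype ι] [Fintype κ] (s : ι → ℕ) (t : κ → ℕ) :
    Eqv ((cliques s).sum (cliques t)) (cliques (Sum.elim s t)) := by
  let f : (Σ i, Option (Fin (s i))) ⊕ (Σ i, Option (Fin (t i))) ≃
      Σ i, Option (Fin (Sum.elim s t i)) :=
    (Equiv.sumSigmaDistrib fun i => Option (Fin (Sum.elim s t i))).symm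
  refine .symm <| .embed f f.injective ?_ fun a ha => absurd (f.surjective a) ha
  intro a b
  have hf : f a ≠ f b ↔ a ≠ b := f.injective.ne_iff
  rcases a with ⟨i, a⟩ | ⟨i, a⟩ <;> rcases b with ⟨j, b⟩ | ⟨j, b⟩
  · refine Sum.liftRel_inl_inl.trans
      (and_congr Sum.inl_injective.eq_iff.symm (hf.trans Sum.inl_injective.ne_iff).symm)
  · exact iff_of_false (by simp) fun h => Sum.inl_ne_inr h.1
  · exact iff_of_false (by simp) fun h => Sum.inr_ne_inl h.1
  · refine Sum.liftRel_inr_inr.trans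
      (and_congr Sum.inr_injective.eq_iff.symm (hf.trans Sum.inr_injective.ne_iff).symm)

theorem HasCliqueType.sum {A B : LoopGraph} {m p m' p' : ℕ} (hA : A.HasCliqueType m p)
    (hB : B.HasCliqueType m' p') : (A.sum B).HasCliqueType (m + m') (p * p') := by
  obtain ⟨h0, ι, _, s, rfl, rfl, h3⟩ := hA
  obtain ⟨h0', κ, _, t, rfl, rfl, h3'⟩ := hB
  refine ⟨?_, ι ⊕ κ, inferInstance, Sum.elim s t, Fintype.card_sum, ?_,
    (h3.sum h3').trans (cliques_sum s t)⟩
  · rw [altCount_sum, h0, h0', pow_add]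
    push_cast
    ring
  · simp

theorem hasCliqueType_of_isEmpty (A : LoopGraph) [IsEmpty A.V] : A.HasCliqueType 0 1 := by
  classical
  refine ⟨?_, Empty, inferInstance, fun _ => 1, rfl, rfl, ?_⟩
  · have : A.indepSets = {∅} := by
      ext I
      simp [mem_indepSets, Finset.eq_empty_of_isEmpty I]
    simp [altCount, this]
  · exact .embed (fun a => a.1.elim) (fun a => a.1.elim) (fun a => a.1.elim) fun a => isEmptyElim a

/-- Replaces the classical decidability instances by computable ones, so that small cases can be
evaluated by `decide`. -/
theorem altCount_eq_sum {V : Type} [Fintype V] [DecidableEq V] (r : V → V → Prop)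
    [DecidableRel r] : altCount ⟨V, r⟩ =
      ∑ I ∈ Finset.univ.filter fun I : Finset V => ∀ a ∈ I, ∀ b ∈ I, ¬ r a b, (-1) ^ I.card := by
  refine Finset.sum_congr ?_ fun _ _ => rfl
  ext I
  exact mem_indepSets.trans (Finset.mem_filter_univ (p := fun I : Finset V =>
    ∀ a ∈ I, ∀ b ∈ I, ¬ r a b) I).symm

/-! ### Cycles -/

/-- Adjacency in the cycle with vertices `0, …, n - 1`. -/
abbrev CycleAdj (n i j : ℕ) : Prop :=
  i + 1 = j ∨ j + 1 = i ∨ (i = 0 ∧ j + 1 = n) ∨ (j = 0 ∧ i + 1 = n)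

/-- The cycle with `n` vertices (an edge for `n = 2`). -/
abbrev cycle (n : ℕ) : LoopGraph := ⟨Fin n, fun i j => CycleAdj n i j⟩

/-- Meant for the edge and the triangle, the cycles that are complete graphs. -/
theorem hasCliqueType_cycle_succ {k : ℕ}
    (h : altCount (cycle (k + 1)) = (-1) ^ 1 * k)
    (hk : ∀ i j : Fin (k + 1), CycleAdj (k + 1) i j ↔ i ≠ j) :
    (cycle (k + 1)).HasCliqueType 1 k := by
  refine ⟨h, Unit, inferInstance, fun _ => k, rfl, by simp, ?_⟩
  refine .embed (fun a => (finSuccEquiv k).symm a.2) ?_ ?_ ?_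
  · rintro ⟨i, a⟩ ⟨j, b⟩ h
    have : a = b := (finSuccEquiv k).symm.injective h
    rw [this]
  · rintro ⟨i, a⟩ ⟨j, b⟩
    refine Iff.trans ?_ (hk _ _).symm
    simp
  · intro a ha
    exact absurd ⟨⟨(), finSuccEquiv k a⟩, (finSuccEquiv k).symm_apply_apply a⟩ ha

theorem hasCliqueType_cycle_two : (cycle 2).HasCliqueType 1 1 :=
  hasCliqueType_cycle_succ (by rw [altCount_eq_sum]; decide) (by decide)

theorem hasCliqueType_cycle_three : (cycle 3).HasCliqueType 1 2 :=
  hasCliqueType_cycle_succ (by rw [altCount_eq_sum]; decide) (by decide)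

/-- Opposite vertices of a square have the same neighbours, so `2` folds onto `0` and `3` onto `1`.
-/
theorem eqv_cycle_four : Eqv (cycle 4) (cycle 2) := by
  refine (Eqv.addLoops {2, 3} (fun i => i - 2) (by decide) (by decide) (by decide)).trans ?_
  refine .embed (Fin.castLE (by norm_num)) (by decide) (by decide) ?_
  have : ∀ a : Fin 4, a ∉ Set.range (Fin.castLE (n := 2) (m := 4) (by norm_num)) →
    (CycleAdj 4 a a ∨ a = a ∧ a ∈ ({2, 3} : Finset (Fin 4))) := by decide
  exact this

theorem CycleAdj.symm {n i j : ℕ} (h : CycleAdj n i j) : CycleAdj n j i := by tauto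

/-- Adjacency in the cycle with vertices `0, …, k + 1` to which the path `0, k + 4, k + 3, k + 2` has
been attached. -/
abbrev TailedCycleAdj (k i j : ℕ) : Prop :=
  (i + 1 = j ∧ i ≠ k + 1) ∨ (j + 1 = i ∧ j ≠ k + 1) ∨ (i = 0 ∧ j = k + 4) ∨ (j = 0 ∧ i = k + 4) ∨
    (i = 0 ∧ j = k + 1) ∨ (j = 0 ∧ i = k + 1)

theorem TailedCycleAdj.symm {k i j : ℕ} (h : TailedCycleAdj k i j) : TailedCycleAdj k j i := by
  tauto

theorem cycleAdj_or_iff (k a b : ℕ) :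
    CycleAdj (k + 5) a b ∨ (a = k + 1 ∧ b = 0) ∨ (a = 0 ∧ b = k + 1) ↔
      TailedCycleAdj k a b ∨ (a = k + 1 ∧ b = k + 2) ∨ (a = k + 2 ∧ b = k + 1) := by
  by_cases h1 : a = k + 1 <;> by_cases h2 : b = k + 1 <;> by_cases h3 : a = 0 <;>
    by_cases h4 : b = 0 <;> simp [h1, h2, h3, h4] <;> omega

theorem tailedCycleAdj_iff_cycleAdj {k a b : ℕ} (ha : a < k + 2) (hb : b < k + 2) :
    TailedCycleAdj k a b ↔ CycleAdj (k + 2) a b := by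
  constructor <;> rintro (h | h | h | h | h) <;> omega

/-- A cycle is shortened by three vertices at the price of an isolated edge. -/
theorem eqv_cycle_add_three (k : ℕ) :
    Eqv (cycle (k + 5)) ((cycle (k + 2)).sum (cycle 2)) := by
  -- Add the chord from `k + 1` to `0`: the neighbours `k + 2` and `k + 4` of `k + 3` are adjacent
  -- to `k + 1` and to `0` respectively.
  have h₁ : Eqv (cycle (k + 5)) ⟨Fin (k + 5), fun i j => CycleAdj (k + 5) i j ∨
      (i = ⟨k + 1, by omega⟩ ∧ j = ⟨0, by omega⟩) ∨
      (i = ⟨0, by omega⟩ ∧ j = ⟨k + 1, by omega⟩)⟩ := by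
    refine .add_of_symm ⟨k + 1, by omega⟩ ⟨0, by omega⟩ ⟨k + 3, by omega⟩ ?_ ?_ ?_
      (fun _ _ => CycleAdj.symm) ?_ fun _ _ => Iff.rfl
    · simp only [ne_eq, Fin.ext_iff]; omega
    · simp only [ne_eq, Fin.ext_iff]; omega
    · rintro (h | h | h | h) <;> simp only at h <;> omega
    · rintro ⟨c, hc⟩ (h | h | h | h) <;> simp only at h
      · exact .inr (.inr (.inr (.inl ⟨rfl, by simp only; omega⟩)))
      · exact .inl (.inl (by simp only; omega))
      · exact absurd h (by omega)
      · exact absurd h (by omega)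
  -- Remove the edge from `k + 1` to `k + 2`, by the move read backwards: the neighbours of `k + 4`
  -- are `0`, joined to `k + 1` by the chord, and `k + 3`, adjacent to `k + 2`.
  have h₂ : Eqv ⟨Fin (k + 5), fun i j => TailedCycleAdj k i j⟩ ⟨Fin (k + 5), fun i j =>
      CycleAdj (k + 5) i j ∨ (i = ⟨k + 1, by omega⟩ ∧ j = ⟨0, by omega⟩) ∨
      (i = ⟨0, by omega⟩ ∧ j = ⟨k + 1, by omega⟩)⟩ := by
    refine .add_of_symm ⟨k + 1, by omega⟩ ⟨k + 2, by omega⟩ ⟨k + 4, by omega⟩ ?_ ?_ ?_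
      (fun _ _ => TailedCycleAdj.symm) ?_ fun a b => ?_
    · simp only [ne_eq, Fin.ext_iff]; omega
    · simp only [ne_eq, Fin.ext_iff]; omega
    · rintro (h | h | h | h | h | h) <;> simp only at h <;> omega
    · rintro ⟨c, hc⟩ (h | h | h | h | h | h) <;> simp only at h
      · exact absurd h (by omega)
      · exact .inr (.inl ⟨by simp only; omega, by simp only; omega⟩)
      · exact absurd h (by omega)
      · exact .inl (.inr (.inr (.inr (.inr (.inr ⟨h.1, rfl⟩)))))
      · exact absurd h (by omega)
      · exact absurd h (by omega)
    · simpa only [Fin.ext_iff] using cycleAdj_or_iff k a b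
  -- Now `k + 2` is a leaf whose only neighbour `k + 3` is also adjacent to `k + 4`, so `k + 4` can
  -- be deleted. This separates the edge from `k + 2` to `k + 3` from the shortened cycle.
  have h₃ : Eqv ⟨Fin (k + 5), fun i j => TailedCycleAdj k i j⟩
      ⟨Fin (k + 5), fun i j => TailedCycleAdj k i j ∨
        ((i : ℕ) = k + 4 ∧ (j : ℕ) = k + 4)⟩ := by
    refine .add_of_symm ⟨k + 4, by omega⟩ ⟨k + 4, by omega⟩ ⟨k + 2, by omega⟩ ?_ ?_ ?_
      (fun _ _ => TailedCycleAdj.symm) ?_ fun a b => ?_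
    · simp only [ne_eq, Fin.ext_iff]; omega
    · simp only [ne_eq, Fin.ext_iff]; omega
    · rintro (h | h | h | h | h | h) <;> simp only at h <;> omega
    · rintro ⟨c, hc⟩ (h | h | h | h | h | h) <;> simp only at h
      · exact .inl (.inr (.inl ⟨by simp only; omega, by simp only; omega⟩))
      all_goals exact absurd h (by omega)
    · simp only [Fin.ext_iff, or_self]
  refine h₁.trans (h₂.symm.trans (h₃.trans ?_))
  refine .embed (Sum.elim (fun i => ⟨i, by omega⟩) (fun i => ⟨k + 2 + i, by omega⟩)) ?_ ?_ ?_
  · rintro (⟨a, ha⟩ | ⟨a, ha⟩) (⟨b, hb⟩ | ⟨b, hb⟩) h <;>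
      simp only [Sum.elim_inl, Sum.elim_inr, Fin.mk.injEq] at h <;>
      simp only [Sum.inl.injEq, Sum.inr.injEq, Fin.mk.injEq, reduceCtorEq] <;> omega
  · rintro (⟨a, ha⟩ | ⟨a, ha⟩) (⟨b, hb⟩ | ⟨b, hb⟩)
    · refine Sum.liftRel_inl_inl.trans ((tailedCycleAdj_iff_cycleAdj ha hb).symm.trans
        (or_iff_left ?_).symm)
      simp only [Sum.elim_inl]; omega
    · refine iff_of_false Sum.not_liftRel_inl_inr ?_
      rintro ((h | h | h | h | h | h) | h) <;> simp only [Sum.elim_inl, Sum.elim_inr] at h <;> omega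
    · refine iff_of_false Sum.not_liftRel_inr_inl ?_
      rintro ((h | h | h | h | h | h) | h) <;> simp only [Sum.elim_inl, Sum.elim_inr] at h <;> omega
    · refine Sum.liftRel_inr_inr.trans ?_
      simp only [Sum.elim_inr, TailedCycleAdj, CycleAdj]
      interval_cases a <;> interval_cases b <;> simp
  · rintro ⟨a, ha⟩ h
    by_cases h1 : a < k + 2
    · exact absurd ⟨.inl ⟨a, h1⟩, rfl⟩ h
    by_cases h2 : a < k + 4
    · exact absurd ⟨.inr ⟨a - (k + 2), by omega⟩, Fin.ext (by simp; omega)⟩ h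
    · exact .inr ⟨by simp; omega, by simp; omega⟩

/-- Each split-off edge is one more clique, contributing a factor `1` to the product. -/
theorem hasCliqueType_cycle_add {n p : ℕ} (hn : 2 ≤ n) (h : (cycle n).HasCliqueType 1 p) (k : ℕ) :
    (cycle (3 * k + n)).HasCliqueType (k + 1) p := by
  induction k with
  | zero => simpa using h
  | succ k ih =>
    obtain ⟨n, rfl⟩ := Nat.exists_eq_add_of_le' hn
    have h1 := (ih.sum hasCliqueType_cycle_two).of_eqv (eqv_cycle_add_three (3 * k + n))
    rw [mul_one] at h1
    rw [show 3 * (k + 1) + (n + 2) = 3 * k + n + 5 by ring]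
    exact h1

/-! ### Cylinders -/

/-- Adjacency in the cylinder of circumference `M`: the vertex `(i, j)` is adjacent to
`(i ± 1, j ± 1)`, and it has a loop if `i + j` is odd. -/
abbrev CylinderAdj (M i j i' j' : ℕ) : Prop :=
  (i = i' ∧ j = j' ∧ (i + j) % 2 = 1) ∨ (CycleAdj M i i' ∧ (j + 1 = j' ∨ j' + 1 = j))

/-- The cylinder with circumference `M` and `N` rows. -/
abbrev cylinder (M N : ℕ) : LoopGraph :=
  ⟨Fin M × Fin N, fun a b => CylinderAdj M a.1 a.2 b.1 b.2⟩

/-- The loopless vertices zigzag between the two rows, one for each residue mod `M`; evenness of `M`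
lets the zigzag close up. -/
theorem eqv_cylinder_two {M : ℕ} (hM : M % 2 = 0) :
    Eqv (cylinder M 2) (cycle M) := by
  refine .embed (fun i => (i, ⟨i % 2, by omega⟩)) ?_ ?_ ?_
  · intro a b h
    exact congrArg Prod.fst h
  · rintro ⟨a, ha⟩ ⟨b, hb⟩
    constructor
    · intro (h : CycleAdj M a b)
      exact .inr ⟨h, by rcases h with h | h | h | h <;> simp only <;> omega⟩
    · rintro (⟨-, -, h⟩ | h)
      · simp only at h; omega
      · exact h.1
  · rintro ⟨⟨a, ha⟩, ⟨b, hb⟩⟩ h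
    refine .inl ⟨rfl, rfl, ?_⟩
    by_contra hab
    refine h ⟨⟨a, ha⟩, ?_⟩
    simp only [Prod.mk.injEq, Fin.mk.injEq, true_and] at hab ⊢
    omega

/-- Row `N + 2` is the last one, so the neighbours of a vertex there lie in row `N + 1` only, where
they are also neighbours of the vertex of row `N` in the same column. Deleting row `N` cuts off the
last two rows, which form a cycle. -/
theorem eqv_cylinder_add_three {M : ℕ} (hM : M % 2 = 0) (N : ℕ) :
    Eqv (cylinder M (N + 3)) ((cycle M).sum (cylinder M N)) := by
  classical
  refine (Eqv.addLoops (Finset.univ.filter fun a : Fin M × Fin (N + 3) =>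
    (a.2 : ℕ) = N ∧ ((a.1 : ℕ) + a.2) % 2 = 0) (fun a => (a.1, ⟨N + 2, by omega⟩))
    ?_ ?_ ?_).trans ?_
  · simp
  · rintro ⟨⟨a, ha⟩, ⟨b, hb⟩⟩ h
    simp only [Finset.mem_filter_univ] at h
    rintro (h' | h') <;> simp only at h' <;> omega
  · rintro ⟨⟨a, ha⟩, ⟨b, hb⟩⟩ h ⟨⟨c, hc⟩, ⟨d, hd⟩⟩
    simp only [Finset.mem_filter_univ] at h
    rintro ((h' | h') | (h' | h')) <;> simp only at h'
    · omega
    · exact .inl (.inr ⟨h'.1, by simp only; omega⟩)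
    · omega
    · exact .inr (.inr ⟨h'.1, by simp only; omega⟩)
  -- In column `i`, the second coordinate selects whichever of the rows `N + 1` and `N + 2` has the
  -- parity of `i`, hence the loopless vertex.
  refine .embed (Sum.elim (fun i => (i, ⟨N + 1 + (i + N + 1) % 2, by omega⟩))
    (fun a => (a.1, ⟨a.2, by omega⟩))) ?_ ?_ ?_
  · rintro (⟨a, ha⟩ | ⟨⟨a, ha⟩, ⟨b, hb⟩⟩) (⟨c, hc⟩ | ⟨⟨c, hc⟩, ⟨d, hd⟩⟩) h <;>
      simp only [Sum.elim_inl, Sum.elim_inr, Prod.mk.injEq, Fin.mk.injEq] at h <;>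
      simp only [Sum.inl.injEq, Sum.inr.injEq, Prod.mk.injEq, Fin.mk.injEq, reduceCtorEq] <;> omega
  · rintro (⟨a, ha⟩ | ⟨⟨a, ha⟩, ⟨b, hb⟩⟩) (⟨c, hc⟩ | ⟨⟨c, hc⟩, ⟨d, hd⟩⟩)
    · refine Sum.liftRel_inl_inl.trans ⟨fun h => .inl (.inr ⟨h, ?_⟩), ?_⟩
      · rcases h with h | h | h | h <;> simp only [Sum.elim_inl] at h ⊢ <;> omega
      · rintro ((h | h) | ⟨-, h⟩)
        · simp only [Sum.elim_inl] at h; omega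
        · exact h.1
        · simp only [Finset.mem_filter_univ, Sum.elim_inl] at h; omega
    · refine iff_of_false (by simp) ?_
      rintro ((⟨-, h, -⟩ | ⟨-, h⟩) | ⟨h, -⟩) <;>
        simp only [Sum.elim_inl, Sum.elim_inr, Prod.mk.injEq, Fin.mk.injEq] at h <;> omega
    · refine iff_of_false (by simp) ?_
      rintro ((⟨-, h, -⟩ | ⟨-, h⟩) | ⟨h, -⟩) <;>
        simp only [Sum.elim_inl, Sum.elim_inr, Prod.mk.injEq, Fin.mk.injEq] at h <;> omega
    · refine Sum.liftRel_inr_inr.trans ⟨.inl, ?_⟩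
      rintro (h | ⟨-, h⟩)
      · exact h
      · simp only [Finset.mem_filter_univ, Sum.elim_inr] at h; omega
  · rintro ⟨⟨a, ha⟩, ⟨b, hb⟩⟩ h
    have h1 : N ≤ b := by
      by_contra hb'
      exact h ⟨.inr (⟨a, ha⟩, ⟨b, by omega⟩), rfl⟩
    have h2 : b ≠ N + 1 + (a + N + 1) % 2 := fun hb' =>
      h ⟨.inl ⟨a, ha⟩, by simp [hb']⟩
    simp only [Finset.mem_filter_univ, true_and]
    by_cases h3 : (a + b) % 2 = 1
    · exact .inl (.inl ⟨rfl, rfl, h3⟩)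
    · exact .inr ⟨by omega, by omega⟩

theorem hasCliqueType_cylinder {M m p : ℕ} (hM : M % 2 = 0) (h : (cycle M).HasCliqueType m p)
    (q : ℕ) : (cylinder M (3 * q)).HasCliqueType (m * q) (p ^ q) ∧
      (cylinder M (3 * q + 2)).HasCliqueType (m * (q + 1)) (p ^ (q + 1)) := by
  induction q with
  | zero =>
    refine ⟨?_, by simpa using h.of_eqv (eqv_cylinder_two hM)⟩
    have : IsEmpty (cylinder M (3 * 0)).V := inferInstanceAs (IsEmpty (Fin M × Fin 0))
    simpa using hasCliqueType_of_isEmpty (cylinder M (3 * 0))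
  | succ q ih =>
    have step : ∀ {N m' p'}, (cylinder M N).HasCliqueType m' p' →
        (cylinder M (N + 3)).HasCliqueType (m + m') (p * p') := fun h' =>
      (h.sum h').of_eqv (eqv_cylinder_add_three hM _)
    refine ⟨?_, ?_⟩
    · rw [show m * (q + 1) = m + m * q by ring, pow_succ']
      exact step ih.1
    · rw [show m * (q + 1 + 1) = m + m * (q + 1) by ring, pow_succ' p (q + 1)]
      exact step ih.2

/-- After splitting off `q` cycles a single row is left. Adjacent vertices lie in different rows, so
its loopless vertex in column `0` is isolated. -/
theorem exists_isolated_cylinder {M : ℕ} (hM : M % 2 = 0) (hM' : 1 ≤ M) (q : ℕ) :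
    ∃ (B : LoopGraph) (w : B.V), Eqv (cylinder M (3 * q + 1)) B ∧
      ∀ c, ¬ B.rel w c ∧ ¬ B.rel c w := by
  induction q with
  | zero =>
    refine ⟨_, (⟨0, hM'⟩, ⟨0, by omega⟩), .refl _, ?_⟩
    rintro ⟨⟨a, ha⟩, ⟨b, hb⟩⟩
    constructor <;> rintro (h | h) <;> simp only at h <;> omega
  | succ q ih =>
    obtain ⟨B, w, hB, hw⟩ := ih
    refine ⟨(cycle M).sum B, .inr w, (eqv_cylinder_add_three hM (3 * q + 1)).trans
      ((Eqv.refl _).sum hB), ?_⟩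
    rintro (c | c)
    · simp
    · simpa using hw c

/-! ### The cylinder as a quotient of a rectangle -/

theorem squareGrid_adj {p q : ℤ × ℤ} : squareGrid.Adj p q ↔
    (p.1 = q.1 ∧ (p.2 + 1 = q.2 ∨ q.2 + 1 = p.2)) ∨
      (p.2 = q.2 ∧ (p.1 + 1 = q.1 ∨ q.1 + 1 = p.1)) := by
  change |p.1 - q.1| + |p.2 - q.2| = 1 ↔ _
  rcases abs_cases (p.1 - q.1) with ⟨h, _⟩ | ⟨h, _⟩ <;>
    rcases abs_cases (p.2 - q.2) with ⟨h', _⟩ | ⟨h', _⟩ <;> rw [h, h'] <;> omega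

/-- The vertex of the cylinder that corresponds to a point of the rectangle. -/
def rectToCylinder {M N : ℕ} (hM : 1 ≤ M) (p : rectVertices (M + 1) N) : Fin M × Fin N :=
  (⟨if p.1.1 - p.1.2 = M then 0 else (p.1.1 - p.1.2).toNat, by
      obtain ⟨h1, h2, h3, h4⟩ := p.2; split_ifs <;> omega⟩,
    ⟨(p.1.1 + p.1.2).toNat, by obtain ⟨h1, h2, h3, h4⟩ := p.2; omega⟩)

theorem rectToCylinder_spec {M N : ℕ} (hM : 1 ≤ M) (p : rectVertices (M + 1) N) :
    (0 ≤ p.1.1 - p.1.2 ∧ p.1.1 - p.1.2 ≤ M ∧ 0 ≤ p.1.1 + p.1.2 ∧ p.1.1 + p.1.2 < N) ∧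
      ((rectToCylinder hM p).2 : ℤ) = p.1.1 + p.1.2 ∧
      ((p.1.1 - p.1.2 = M ∧ ((rectToCylinder hM p).1 : ℤ) = 0) ∨
        (p.1.1 - p.1.2 < M ∧ ((rectToCylinder hM p).1 : ℤ) = p.1.1 - p.1.2)) := by
  obtain ⟨h1, h2, h3, h4⟩ := p.2
  refine ⟨by omega, ?_, ?_⟩
  · simp only [rectToCylinder]; omega
  · simp only [rectToCylinder]; split_ifs <;> omega

/-- The vertex of the cylinder that corresponds to a vertex of `cylRect M N`. -/
def cylToCylinder {M N : ℕ} (hM : 1 ≤ M) (hM2 : M % 2 = 0) (a : CylVertices M N) :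
    Fin M × Fin N :=
  Quot.lift (rectToCylinder hM) (by
    rintro p q ⟨i, h1, h2, h3, h4⟩
    have h5 := congrArg Prod.fst h3
    have h6 := congrArg Prod.snd h3
    have h7 := congrArg Prod.fst h4
    have h8 := congrArg Prod.snd h4
    have hp := rectToCylinder_spec hM p
    have hq := rectToCylinder_spec hM q
    simp only at h5 h6 h7 h8
    refine Prod.ext (Fin.ext ?_) (Fin.ext ?_) <;> omega) a

theorem cylToCylinder_injective {M N : ℕ} (hM : 1 ≤ M) (hM2 : M % 2 = 0) :
    Function.Injective (cylToCylinder (N := N) hM hM2) := by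
  rintro ⟨p⟩ ⟨q⟩ h
  have h : rectToCylinder hM p = rectToCylinder hM q := h
  have h1 : ((rectToCylinder hM p).1 : ℕ) = (rectToCylinder hM q).1 := by rw [h]
  have h2 : ((rectToCylinder hM p).2 : ℕ) = (rectToCylinder hM q).2 := by rw [h]
  have hp := rectToCylinder_spec hM p
  have hq := rectToCylinder_spec hM q
  clear h
  by_cases hxy : p.1.1 = q.1.1 ∧ p.1.2 = q.1.2
  · rw [Subtype.ext (Prod.ext hxy.1 hxy.2)]
  -- Distinct points with the same image lie on opposite sides of the seam at equal height; the
  -- cases tell which of them is on the side `x = y`.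
  by_cases hx : p.1.1 = p.1.2
  · refine Quot.sound ⟨p.1.1, by omega, by omega, Prod.ext ?_ ?_, Prod.ext ?_ ?_⟩ <;>
      simp only <;> omega
  · refine (Quot.sound ⟨q.1.1, by omega, by omega, Prod.ext ?_ ?_, Prod.ext ?_ ?_⟩).symm <;>
      simp only <;> omega

/-- The value `u = M` is allowed because an edge between columns `M - 1` and `0` comes from an edge
of the rectangle ending on its far side. -/
theorem exists_rectToCylinder_eq {M N : ℕ} (hM : 1 ≤ M) (hM2 : M % 2 = 0) {u v : ℕ} (hu : u ≤ M)
    (hv : v < N) (huv : (u + v) % 2 = 0) : ∃ p : rectVertices (M + 1) N,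
      p.1.1 - p.1.2 = u ∧ p.1.1 + p.1.2 = v ∧ ((rectToCylinder hM p).2 : ℕ) = v ∧
      ((rectToCylinder hM p).1 : ℕ) = if u = M then 0 else u := by
  let p : rectVertices (M + 1) N := ⟨(((u : ℤ) + v) / 2, ((v : ℤ) - u) / 2), by
    refine ⟨?_, ?_, ?_, ?_⟩ <;> simp only <;> omega⟩
  have h1 : p.1.1 = ((u : ℤ) + v) / 2 := rfl
  have h2 : p.1.2 = ((v : ℤ) - u) / 2 := rfl
  have hp := rectToCylinder_spec hM p
  refine ⟨p, by omega, by omega, by omega, ?_⟩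
  split_ifs <;> omega

theorem cylToCylinder_even {M N : ℕ} (hM : 1 ≤ M) (hM2 : M % 2 = 0) (a : CylVertices M N) :
    (((cylToCylinder hM hM2 a).1 : ℕ) + (cylToCylinder hM hM2 a).2) % 2 = 0 := by
  obtain ⟨p⟩ := a
  change (((rectToCylinder hM p).1 : ℕ) + (rectToCylinder hM p).2) % 2 = 0
  have hp := rectToCylinder_spec hM p
  omega

theorem cylRect_adj_iff {M N : ℕ} (hM : 1 ≤ M) (hM2 : M % 2 = 0) (a b : CylVertices M N) :
    (cylRect M N).Adj a b ↔
      (cylinder M N).rel (cylToCylinder hM hM2 a) (cylToCylinder hM hM2 b) := by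
  constructor
  · have key : ∀ p q : rectVertices (M + 1) N, (rect (M + 1) N).Adj p q →
        (cylinder M N).rel (rectToCylinder hM p) (rectToCylinder hM q) := by
      intro p q h
      have h := squareGrid_adj.1 h
      have hp := rectToCylinder_spec hM p
      have hq := rectToCylinder_spec hM q
      have h1 : p.1.1 - p.1.2 + 1 = q.1.1 - q.1.2 ∨ q.1.1 - q.1.2 + 1 = p.1.1 - p.1.2 := by
        simp only [Function.Embedding.coe_subtype] at h
        omega
      have h2 : p.1.1 + p.1.2 + 1 = q.1.1 + q.1.2 ∨ q.1.1 + q.1.2 + 1 = p.1.1 + p.1.2 := by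
        simp only [Function.Embedding.coe_subtype] at h
        omega
      clear h
      refine .inr ⟨?_, by omega⟩
      rcases h1 with h1 | h1 <;> simp only [CycleAdj] <;> omega
    have hsymm : ∀ a b, (cylinder M N).rel a b → (cylinder M N).rel b a := by
      rintro a b (⟨h1, h2, h3⟩ | ⟨h1, h2⟩)
      · exact .inl ⟨h1.symm, h2.symm, by omega⟩
      · refine .inr ⟨?_, h2.symm⟩
        exact h1.symm
    intro h
    rw [cylRect, SimpleGraph.fromRel_adj] at h
    obtain ⟨-, ⟨p, q, h, rfl, rfl⟩ | ⟨p, q, h, rfl, rfl⟩⟩ := h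
    · exact key p q h
    · exact hsymm _ _ (key p q h)
  · intro h
    have ha := cylToCylinder_even hM hM2 a
    have hb := cylToCylinder_even hM hM2 b
    rcases h with ⟨h1, h2, h3⟩ | ⟨h1, h2⟩
    · omega
    have hab : a ≠ b := by
      rintro rfl
      omega
    -- Lift the two columns to adjacent integers in `[0, M]`: column `0` lifts to `M` when the edge
    -- crosses the seam.
    obtain ⟨u, u', hu, hu', huu', hua, hub⟩ : ∃ u u' : ℕ, u ≤ M ∧ u' ≤ M ∧
        (u + 1 = u' ∨ u' + 1 = u) ∧
        (if u = M then 0 else u) = ((cylToCylinder hM hM2 a).1 : ℕ) ∧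
        (if u' = M then 0 else u') = ((cylToCylinder hM hM2 b).1 : ℕ) := by
      have h3 := (cylToCylinder hM hM2 a).1.2
      have h4 := (cylToCylinder hM hM2 b).1.2
      rcases h1 with h | h | h | h
      · exact ⟨_, _, h3.le, h4.le, .inl h, if_neg h3.ne, if_neg h4.ne⟩
      · exact ⟨_, _, h3.le, h4.le, .inr h, if_neg h3.ne, if_neg h4.ne⟩
      · exact ⟨M, _, le_rfl, h4.le, .inr h.2, (if_pos rfl).trans h.1.symm, if_neg h4.ne⟩
      · exact ⟨_, M, h3.le, le_rfl, .inl h.2, if_neg h3.ne, (if_pos rfl).trans h.1.symm⟩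
    have hua' : (u : ℕ) % 2 = ((cylToCylinder hM hM2 a).1 : ℕ) % 2 := by
      split_ifs at hua <;> omega
    have hub' : (u' : ℕ) % 2 = ((cylToCylinder hM hM2 b).1 : ℕ) % 2 := by
      split_ifs at hub <;> omega
    obtain ⟨p, hp1, hp2, hp3, hp4⟩ := exists_rectToCylinder_eq hM hM2 hu
      (cylToCylinder hM hM2 a).2.2 (by omega)
    obtain ⟨q, hq1, hq2, hq3, hq4⟩ := exists_rectToCylinder_eq hM hM2 hu'
      (cylToCylinder hM hM2 b).2.2 (by omega)
    rw [cylRect, SimpleGraph.fromRel_adj]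
    refine ⟨hab, .inl ⟨p, q, squareGrid_adj.2 ?_, cylToCylinder_injective hM hM2 ?_,
      cylToCylinder_injective hM hM2 ?_⟩⟩
    · rw [Function.Embedding.coe_subtype]
      rcases huu' with h5 | h5 <;> rcases h2 with h6 | h6
      · exact .inr ⟨by omega, .inl (by omega)⟩
      · exact .inl ⟨by omega, .inr (by omega)⟩
      · exact .inl ⟨by omega, .inl (by omega)⟩
      · exact .inr ⟨by omega, .inr (by omega)⟩
    · exact Prod.ext (Fin.ext (hp4.trans hua)) (Fin.ext hp3)
    · exact Prod.ext (Fin.ext (hq4.trans hub)) (Fin.ext hq3)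

theorem eqv_cylRect {M N : ℕ} (hM : 1 ≤ M) (hM2 : M % 2 = 0) :
    Eqv (ofSimpleGraph (cylRect M N)) (cylinder M N) := by
  refine .symm <| .embed (cylToCylinder hM hM2) (cylToCylinder_injective hM hM2)
    (cylRect_adj_iff hM hM2) ?_
  rintro ⟨⟨u, hu⟩, ⟨v, hv⟩⟩ h
  refine .inl ⟨rfl, rfl, ?_⟩
  by_contra huv
  obtain ⟨p, -, -, h1, h2⟩ := exists_rectToCylinder_eq hM hM2 hu.le hv (by simp only at huv; omega)
  exact h ⟨Quot.mk _ p, Prod.ext (Fin.ext (h2.trans (if_neg hu.ne))) (Fin.ext h1)⟩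

end LoopGraph

/-! ### Wedges -/

/-- Wedges of copies of homeomorphic pointed spaces over equivalent index types are homeomorphic. -/
theorem Wedge.nonempty_homeomorph {ι κ X Y : Type*} [TopologicalSpace X] [TopologicalSpace Y]
    (e : ι ≃ κ) (φ : X ≃ₜ Y) {x₀ : X} {y₀ : Y} (h : φ x₀ = y₀) :
    Nonempty (Wedge (fun _ : ι => x₀) ≃ₜ Wedge (fun _ : κ => y₀)) := by
  subst h
  have h1 : Continuous (Sum.map id (Sigma.map e fun _ => φ) :
      (Unit ⊕ Σ _ : ι, X) → (Unit ⊕ Σ _ : κ, Y)) :=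
    continuous_id.sumMap (Continuous.sigma_map fun _ => φ.continuous)
  have h2 : Continuous (Sum.map id (Sigma.map e.symm fun _ => φ.symm) :
      (Unit ⊕ Σ _ : κ, Y) → (Unit ⊕ Σ _ : ι, X)) :=
    continuous_id.sumMap (Continuous.sigma_map fun _ => φ.symm.continuous)
  refine ⟨{
    toFun := Quot.map (Sum.map id (Sigma.map e fun _ => φ)) ?_
    invFun := Quot.map (Sum.map id (Sigma.map e.symm fun _ => φ.symm)) ?_
    left_inv := ?_
    right_inv := ?_
    continuous_toFun := continuous_quot_lift _ (continuous_quot_mk.comp h1)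
    continuous_invFun := continuous_quot_lift _ (continuous_quot_mk.comp h2) }⟩
  · rintro _ _ ⟨i⟩
    exact WedgeRel.glue (x₀ := fun _ : κ => φ x₀) (e i)
  · rintro _ _ ⟨i⟩
    have := WedgeRel.glue (x₀ := fun _ : ι => x₀) (e.symm i)
    simpa [Sigma.map] using this
  · rintro ⟨_ | ⟨i, x⟩⟩
    · rfl
    · simp [Quot.map, Sigma.map]
  · rintro ⟨_ | ⟨i, x⟩⟩
    · rfl
    · simp [Quot.map, Sigma.map]

/-- A wedge with one summand is homeomorphic to the summand. -/
theorem Wedge.nonempty_homeomorph_of_unique {ι X : Type*} [Unique ι] [TopologicalSpace X] (x₀ : X) :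
    Nonempty (Wedge (fun _ : ι => x₀) ≃ₜ X) := by
  refine ⟨{
    toFun := Quot.lift (Sum.elim (fun _ => x₀) fun a => a.2) (by rintro _ _ ⟨i⟩; rfl)
    invFun := fun x => Quot.mk _ (.inr ⟨default, x⟩)
    left_inv := ?_
    right_inv := fun x => rfl
    continuous_toFun := continuous_quot_lift _ <| continuous_const.sumElim <|
      continuous_sigma fun _ => continuous_id
    continuous_invFun := continuous_quot_mk.comp <| continuous_inr.comp continuous_sigmaMk }⟩
  rintro ⟨_ | ⟨i, x⟩⟩
  · exact (Quot.sound (WedgeRel.glue default)).symm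
  · rw [Subsingleton.elim i default]
    rfl

/-- Any two pointed Euclidean unit spheres of the same dimension are homeomorphic. -/
theorem nonempty_sphere_homeomorph {ι : Type*} [Fintype ι] {d : ℕ} (hd : Fintype.card ι = d + 1)
    (b : Metric.sphere (0 : EuclideanSpace ℝ ι) 1) :
    ∃ φ : Metric.sphere (0 : EuclideanSpace ℝ ι) 1 ≃ₜ Sphere d, φ b = Sphere.base d := by
  classical
  let L : EuclideanSpace ℝ ι ≃ₗᵢ[ℝ] EuclideanSpace ℝ (Fin (d + 1)) :=
    LinearIsometryEquiv.piLpCongrLeft 2 ℝ ℝ (Fintype.equivFinOfCardEq hd)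
  have hb : ‖L b‖ = ‖(Sphere.base d : EuclideanSpace ℝ (Fin (d + 1)))‖ := by
    rw [L.norm_map, norm_eq_of_mem_sphere, norm_eq_of_mem_sphere]
  -- The reflection exchanging the two unit vectors `L b` and `Sphere.base d`.
  let R := Submodule.reflection (ℝ ∙ (L b - (Sphere.base d : EuclideanSpace ℝ (Fin (d + 1)))))ᗮ
  let T := L.trans R
  have hT : ∀ z, z ∈ Metric.sphere (0 : EuclideanSpace ℝ ι) 1 ↔
      T z ∈ Metric.sphere (0 : EuclideanSpace ℝ (Fin (d + 1))) 1 := fun z => by simp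
  exact ⟨T.toHomeomorph.subtype hT, Subtype.ext (Submodule.reflection_sub hb)⟩

/-! ### A flow on the sphere -/

/-- A flow on the sphere towards a point `b` with negative coordinates, which pushes all points with
some nonpositive coordinate into `b` and preserves the nonpositivity of every coordinate. -/
theorem exists_sphere_flow {ι : Type*} [Fintype ι] [Nonempty ι]
    (b : Metric.sphere (0 : EuclideanSpace ℝ ι) 1) (hb : ∀ i, b.1 i < 0) :
    ∃ h : C(unitInterval × Metric.sphere (0 : EuclideanSpace ℝ ι) 1,
        Metric.sphere (0 : EuclideanSpace ℝ ι) 1),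
      (∀ z, h (0, z) = z) ∧ (∀ t, h (t, b) = b) ∧
      (∀ z : Metric.sphere (0 : EuclideanSpace ℝ ι) 1, (∃ i, z.1 i ≤ 0) → h (1, z) = b) ∧
      ∀ t (z : Metric.sphere (0 : EuclideanSpace ℝ ι) 1) i, z.1 i ≤ 0 → (h (t, z)).1 i ≤ 0 := by
  have hcl : IsClosed {z : Metric.sphere (0 : EuclideanSpace ℝ ι) 1 | ∃ i, z.1 i ≤ 0} := by
    rw [Set.ofPred_exists]
    refine isClosed_iUnion_of_finite fun i => isClosed_le ?_ continuous_const
    fun_prop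
  -- The flow follows normalized segments towards `b`, with a speed `c` that vanishes at the
  -- antipode `-b`, where the segment would meet the origin, and equals `1` where some coordinate is
  -- nonpositive. These sets are disjoint because `-b` has positive coordinates only.
  obtain ⟨c, hc0, hc1, hc⟩ := exists_continuous_zero_one_of_isClosed
    (isClosed_singleton (x := -b)) hcl (by
      rw [Set.disjoint_singleton_left]
      rintro ⟨i, hi⟩
      have := hb i
      simp at hi
      linarith)
  let l : unitInterval × Metric.sphere (0 : EuclideanSpace ℝ ι) 1 → ℝ := fun p => p.1 * c p.2
  have hl0 : ∀ p, 0 ≤ l p := fun p => mul_nonneg p.1.2.1 (hc p.2).1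
  have hl1 : ∀ p, l p ≤ 1 := fun p => mul_le_one₀ p.1.2.2 (hc p.2).1 (hc p.2).2
  let v : unitInterval × Metric.sphere (0 : EuclideanSpace ℝ ι) 1 → EuclideanSpace ℝ ι :=
    fun p => (1 - l p) • p.2.1 + l p • b.1
  have hlc : Continuous l := by fun_prop
  have hvc : Continuous v := by fun_prop
  -- Comparing norms, the segment could vanish only at its midpoint and only from `-b`, which does
  -- not move.
  have hv : ∀ p, v p ≠ 0 := by
    intro p hp
    have h1 : (1 - l p) • p.2.1 = -(l p • b.1) := eq_neg_of_add_eq_zero_left hp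
    have h2 := congrArg norm h1
    rw [norm_neg, norm_smul, norm_smul, norm_eq_of_mem_sphere, norm_eq_of_mem_sphere,
      Real.norm_of_nonneg (by linarith [hl1 p]), Real.norm_of_nonneg (hl0 p)] at h2
    have h3 : l p = 1 / 2 := by linarith
    have h4 : p.2 = -b := by
      refine Subtype.ext ?_
      rw [h3, ← smul_neg, show (1 : ℝ) - 1 / 2 = 1 / 2 by norm_num] at h1
      exact smul_right_injective _ (by norm_num : (1 / 2 : ℝ) ≠ 0) h1
    have h5 : c p.2 = 0 := hc0 h4
    simp [l, h5] at h3
  have hn : ∀ z : Metric.sphere (0 : EuclideanSpace ℝ ι) 1, ‖z.1‖ = 1 := norm_eq_of_mem_sphere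
  refine ⟨⟨fun p => ⟨‖v p‖⁻¹ • v p, ?_⟩, ?_⟩, ?_, ?_, ?_, ?_⟩
  · rw [mem_sphere_zero_iff_norm, norm_smul, norm_inv, norm_norm,
      inv_mul_cancel₀ (norm_ne_zero_iff.2 (hv p))]
  · exact Continuous.subtype_mk ((hvc.norm.inv₀ fun p => norm_ne_zero_iff.2 (hv p)).smul hvc) _
  · intro z
    have : v (0, z) = z := by simp [v, l]
    refine Subtype.ext ?_
    change ‖v (0, z)‖⁻¹ • v (0, z) = z
    rw [this, hn, inv_one, one_smul]
  · intro t
    have : v (t, b) = b := by simp only [v, ← add_smul]; simp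
    refine Subtype.ext ?_
    change ‖v (t, b)‖⁻¹ • v (t, b) = b
    rw [this, hn, inv_one, one_smul]
  · intro z hz
    have : v (1, z) = b := by
      have : c z = 1 := hc1 hz
      simp [v, l, this]
    refine Subtype.ext ?_
    change ‖v (1, z)‖⁻¹ • v (1, z) = b
    rw [this, hn, inv_one, one_smul]
  · intro t z i hz
    change ‖v (t, z)‖⁻¹ * ((1 - l (t, z)) * z.1 i + l (t, z) * b.1 i) ≤ 0
    refine mul_nonpos_of_nonneg_of_nonpos (inv_nonneg.2 (norm_nonneg _)) (add_nonpos ?_ ?_)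
    · exact mul_nonpos_of_nonneg_of_nonpos (by linarith [hl1 (t, z)]) hz
    · exact mul_nonpos_of_nonneg_of_nonpos (hl0 _) (hb i).le

namespace LoopGraph

/-! ### The independence complex of a disjoint union of cliques -/

section

variable {ι : Type} [Fintype ι] {s : ι → ℕ}

/-- The points whose support meets the `i`-th clique in `none` or `ε i` only. -/
def orthant (ε : ∀ i, Fin (s i)) : Set (cliques s).realization :=
  {x | ∀ i e, e ≠ ε i → x.1 ⟨i, some e⟩ = 0}

theorem isClosed_orthant (ε : ∀ i, Fin (s i)) : IsClosed (orthant ε) := by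
  simp only [orthant, Set.ofPred_forall]
  refine isClosed_iInter fun i => isClosed_iInter fun e => isClosed_iInter fun _ =>
    isClosed_eq ?_ continuous_const
  exact (continuous_apply _).comp continuous_subtype_val

theorem mul_eq_zero_of_ne (x : (cliques s).realization) (i : ι) {a b : Option (Fin (s i))}
    (h : a ≠ b) : x.1 ⟨i, a⟩ * x.1 ⟨i, b⟩ = 0 :=
  x.2.2 ⟨i, a⟩ ⟨i, b⟩ ⟨rfl, by simpa using h⟩

theorem exists_mem_orthant (hs : ∀ i, 0 < s i) (x : (cliques s).realization) :
    ∃ ε, x ∈ orthant ε := by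
  have : ∀ i, ∃ e : Fin (s i), ∀ e', e' ≠ e → x.1 ⟨i, some e'⟩ = 0 := by
    intro i
    by_cases h : ∃ e : Fin (s i), x.1 ⟨i, some e⟩ ≠ 0
    · obtain ⟨e, he⟩ := h
      refine ⟨e, fun e' he' => ?_⟩
      exact (mul_eq_zero.1 (mul_eq_zero_of_ne x i
        (fun h => he' (Option.some_injective _ h)))).resolve_right he
    · push Not at h
      exact ⟨⟨0, hs i⟩, fun e' _ => h e'⟩
  choose ε hε using this
  exact ⟨ε, hε⟩

/-- The signed coordinates of a point. -/
def signedCoord (x : (cliques s).realization) : EuclideanSpace ℝ ι :=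
  WithLp.toLp 2 fun i => ∑ e, x.1 ⟨i, some e⟩ - x.1 ⟨i, none⟩

theorem continuous_signedCoord : Continuous (signedCoord (s := s)) := by
  refine (PiLp.continuous_toLp 2 _).comp (continuous_pi fun i => ?_)
  have : ∀ a, Continuous fun x : (cliques s).realization => x.1 a := fun a =>
    (continuous_apply a).comp continuous_subtype_val
  exact (continuous_finsetSum _ fun e _ => this _).sub (this _)

theorem signedCoord_apply {ε : ∀ i, Fin (s i)} {x : (cliques s).realization} (hx : x ∈ orthant ε)
    (i : ι) : signedCoord x i = x.1 ⟨i, some (ε i)⟩ - x.1 ⟨i, none⟩ := by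
  change ∑ e, x.1 ⟨i, some e⟩ - x.1 ⟨i, none⟩ = _
  rw [Finset.sum_eq_single (ε i) (fun e _ he => hx i e he) (by simp)]

/-- The point of an orthant with given signed coordinates, up to scaling. -/
noncomputable def ofSigned (ε : ∀ i, Fin (s i)) (z : EuclideanSpace ℝ ι)
    (a : Σ i, Option (Fin (s i))) : ℝ :=
  (∑ i, |z i|)⁻¹ * a.2.elim (max (-z a.1) 0) fun e => if e = ε a.1 then max (z a.1) 0 else 0

theorem sum_abs_pos {z : EuclideanSpace ℝ ι} (hz : z ≠ 0) : 0 < ∑ i, |z i| := by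
  obtain ⟨i, hi⟩ : ∃ i, z i ≠ 0 := by
    by_contra! h
    exact hz (PiLp.ext h)
  exact Finset.sum_pos' (fun i _ => abs_nonneg _) ⟨i, Finset.mem_univ i, abs_pos.2 hi⟩

theorem ofSigned_mem (ε : ∀ i, Fin (s i)) {z : EuclideanSpace ℝ ι} (hz : z ≠ 0) :
    ofSigned ε z ∈ (cliques s).realization := by
  have hN := sum_abs_pos hz
  refine ⟨⟨?_, ?_⟩, ?_⟩
  · rintro ⟨i, _ | e⟩
    · exact mul_nonneg (inv_nonneg.2 hN.le) (le_max_right _ _)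
    · refine mul_nonneg (inv_nonneg.2 hN.le) ?_
      simp only [Option.elim_some]
      split_ifs
      exacts [le_max_right _ _, le_rfl]
  · simp only [ofSigned, ← Finset.mul_sum]
    rw [inv_mul_eq_one₀ hN.ne', Fintype.sum_sigma]
    refine Finset.sum_congr rfl fun i _ => ?_
    simp only [Fintype.sum_option, Option.elim_none, Option.elim_some, Finset.sum_ite_eq',
      Finset.mem_univ, if_true]
    rcases le_total (z i) 0 with h | h
    · rw [abs_of_nonpos h, max_eq_left (by linarith), max_eq_right h, add_zero]
    · rw [abs_of_nonneg h, max_eq_right (by linarith), max_eq_left h, zero_add]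
  · rintro ⟨i, a⟩ ⟨j, b⟩ ⟨h1, h2⟩
    simp only at h1
    subst h1
    have hab : a ≠ b := fun h => h2 (by rw [h])
    have hz : max (-z i) 0 = 0 ∨ max (z i) 0 = 0 := by
      rcases le_total (z i) 0 with h | h
      · exact .inr (max_eq_right h)
      · exact .inl (max_eq_right (by linarith))
    rcases a with _ | a <;> rcases b with _ | b
    · exact absurd rfl hab
    · rcases hz with h | h <;> simp [ofSigned, h]
    · rcases hz with h | h <;> simp [ofSigned, h]
    · have : a ≠ b := fun h => hab (by rw [h])
      by_cases h : a = ε i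
      · have hb : b ≠ ε i := fun h' => this (h.trans h'.symm)
        simp [ofSigned, hb]
      · simp [ofSigned, h]

theorem continuousOn_ofSigned (ε : ∀ i, Fin (s i)) : ContinuousOn (ofSigned ε) {z | z ≠ 0} := by
  refine continuousOn_pi.2 fun a => ContinuousOn.mul ?_ (Continuous.continuousOn ?_)
  · refine ContinuousOn.inv₀ (Continuous.continuousOn (by fun_prop)) fun z hz => ?_
    exact (sum_abs_pos hz).ne'
  · rcases a with ⟨i, _ | e⟩
    · simp only [Option.elim_none]; fun_prop
    · simp only [Option.elim_some]
      split_ifs <;> fun_prop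

theorem ofSigned_smul (ε : ∀ i, Fin (s i)) {c : ℝ} (hc : 0 < c) (z : EuclideanSpace ℝ ι) :
    ofSigned ε (c • z) = ofSigned ε z := by
  funext a
  have h1 : ∑ i, |(c • z) i| = c * ∑ i, |z i| := by
    simp [Finset.mul_sum, abs_mul, abs_of_pos hc]
  have h2 : ∀ r : ℝ, max (c * r) 0 = c * max r 0 := fun r => by
    rw [mul_max_of_nonneg _ _ hc.le, mul_zero]
  have h3 : ∀ r : ℝ, (∑ i, |(c • z) i|)⁻¹ * (c * r) = (∑ i, |z i|)⁻¹ * r := fun r => by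
    rw [h1, mul_inv, mul_mul_mul_comm, inv_mul_cancel₀ hc.ne', one_mul]
  rcases a with ⟨i, _ | e⟩
  · change (∑ i, |(c • z) i|)⁻¹ * max (-(c * z i)) 0 = (∑ i, |z i|)⁻¹ * max (-z i) 0
    rw [← mul_neg, h2, h3]
  · change (∑ i, |(c • z) i|)⁻¹ * (if e = ε i then max (c * z i) 0 else 0) =
      (∑ i, |z i|)⁻¹ * (if e = ε i then max (z i) 0 else 0)
    split_ifs
    · rw [h2, h3]
    · rw [mul_zero, mul_zero]

/-- The choice `ε i` only decides where the positive part of `z i` is placed; the negative part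
always goes to `none`. -/
theorem ofSigned_congr {ε ε' : ∀ i, Fin (s i)} {z : EuclideanSpace ℝ ι}
    (h : ∀ i, ε i ≠ ε' i → z i ≤ 0) : ofSigned ε z = ofSigned ε' z := by
  funext ⟨i, a⟩
  by_cases hi : ε i = ε' i
  · simp only [ofSigned, hi]
  · rcases a with _ | e
    · rfl
    · simp [ofSigned, max_eq_right (h i hi)]

/-- In each clique at most one of the weights on `ε i` and `none` is nonzero, so the absolute value
of their difference is their sum. An orthant thus becomes the unit sphere of the `ℓ¹` norm. -/
theorem sum_abs_signedCoord {ε : ∀ i, Fin (s i)} {x : (cliques s).realization}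
    (hx : x ∈ orthant ε) : ∑ i, |signedCoord x i| = 1 := by
  rw [← x.2.1.2, Fintype.sum_sigma]
  refine Finset.sum_congr rfl fun i _ => ?_
  rw [signedCoord_apply hx, Fintype.sum_option,
    Finset.sum_eq_single (ε i) (fun e _ he => hx i e he) (by simp)]
  have h1 := x.2.1.1 ⟨i, some (ε i)⟩
  have h2 := x.2.1.1 ⟨i, none⟩
  rcases mul_eq_zero.1 (mul_eq_zero_of_ne x i (Option.some_ne_none (ε i))) with h | h
  · rw [h, zero_sub, abs_neg, abs_of_nonneg h2, add_zero]
  · rw [h, sub_zero, abs_of_nonneg h1, zero_add]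

theorem ofSigned_signedCoord {ε : ∀ i, Fin (s i)} {x : (cliques s).realization}
    (hx : x ∈ orthant ε) : ofSigned ε (signedCoord x) = x := by
  funext ⟨i, a⟩
  rw [ofSigned, sum_abs_signedCoord hx, inv_one, one_mul]
  simp only [signedCoord_apply hx]
  have h1 := x.2.1.1 ⟨i, some (ε i)⟩
  have h2 := x.2.1.1 ⟨i, none⟩
  have h3 := mul_eq_zero.1 (mul_eq_zero_of_ne x i (Option.some_ne_none (ε i)))
  rcases a with _ | e
  · rcases h3 with h | h
    · simp [h, h2]
    · simp [h, h1]
  · simp only [Option.elim_some]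
    split_ifs with he
    · subst he
      rcases h3 with h | h
      · simp [h, h2]
      · simp [h, h1]
    · exact (hx i e he).symm

theorem signedCoord_ofSigned (ε : ∀ i, Fin (s i)) {z : EuclideanSpace ℝ ι} (hz : z ≠ 0) :
    signedCoord ⟨ofSigned ε z, ofSigned_mem ε hz⟩ = (∑ i, |z i|)⁻¹ • z := by
  ext i
  change ∑ e, ofSigned ε z ⟨i, some e⟩ - ofSigned ε z ⟨i, none⟩ = (∑ i, |z i|)⁻¹ * z i
  simp only [ofSigned, Option.elim_some, Option.elim_none, ← Finset.mul_sum, Finset.sum_ite_eq',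
    Finset.mem_univ, if_true, ← mul_sub]
  congr 1
  rcases le_total (z i) 0 with h | h
  · rw [max_eq_right h, max_eq_left (by linarith)]; ring
  · rw [max_eq_left h, max_eq_right (by linarith)]; ring

theorem ofSigned_mem_orthant (ε : ∀ i, Fin (s i)) {z : EuclideanSpace ℝ ι} (hz : z ≠ 0) :
    (⟨ofSigned ε z, ofSigned_mem ε hz⟩ : (cliques s).realization) ∈ orthant ε := by
  intro i e he
  simp [ofSigned, he]

/-- The independence complex of a disjoint union of cliques of orders `s i + 1 ≥ 2` is homotopy
equivalent to a wedge of spheres indexed by `∀ i, Fin (s i)`. -/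
theorem nonempty_homotopyEquiv_cliques [Nonempty ι] (hs : ∀ i, 0 < s i)
    (b : Metric.sphere (0 : EuclideanSpace ℝ ι) 1) (hb : ∀ i, b.1 i < 0) :
    Nonempty (ContinuousMap.HomotopyEquiv (cliques s).realization
      (Wedge fun _ : (∀ i, Fin (s i)) => b)) := by
  obtain ⟨h, h0, hhb, h1, hneg⟩ := exists_sphere_flow b hb
  have hz0 : ∀ z : Metric.sphere (0 : EuclideanSpace ℝ ι) 1, z.1 ≠ 0 := fun z hz => by
    have := norm_eq_of_mem_sphere z
    simp [hz] at this
  have hy0 : ∀ x : (cliques s).realization, signedCoord x ≠ 0 := fun x hx => by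
    obtain ⟨ε, hε⟩ := exists_mem_orthant hs x
    have := sum_abs_signedCoord hε
    simp [hx] at this
  -- An arbitrary choice of orthant, not continuous in `x`. The maps built from it are continuous
  -- because they agree on overlaps with formulas that use a fixed `ε` on each of finitely many
  -- closed orthants.
  choose sel hsel using exists_mem_orthant (s := s) hs
  have hkm : ∀ x : (cliques s).realization, ‖signedCoord x‖⁻¹ • signedCoord x ∈
      Metric.sphere (0 : EuclideanSpace ℝ ι) 1 := fun x => by
    rw [mem_sphere_zero_iff_norm, norm_smul, norm_inv, norm_norm,
      inv_mul_cancel₀ (norm_ne_zero_iff.2 (hy0 x))]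
  have hkc : Continuous fun x : (cliques s).realization => ‖signedCoord x‖⁻¹ • signedCoord x :=
    (continuous_signedCoord.norm.inv₀ fun x => norm_ne_zero_iff.2 (hy0 x)).smul
      continuous_signedCoord
  let k : C((cliques s).realization, Metric.sphere (0 : EuclideanSpace ℝ ι) 1) :=
    ⟨fun x => ⟨‖signedCoord x‖⁻¹ • signedCoord x, hkm x⟩, hkc.subtype_mk hkm⟩
  let g : ∀ _ : (∀ i, Fin (s i)), C(Metric.sphere (0 : EuclideanSpace ℝ ι) 1,
      (cliques s).realization) := fun ε =>
    ⟨fun z => ⟨ofSigned ε z, ofSigned_mem ε (hz0 z)⟩, Continuous.subtype_mk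
      ((continuousOn_ofSigned ε).comp_continuous continuous_subtype_val hz0) _⟩
  have hg : ∀ ε z, g ε z ∈ orthant ε := fun ε z => ofSigned_mem_orthant ε (hz0 z)
  have hkg : ∀ ε z, k (g ε z) = z := fun ε z => by
    refine Subtype.ext ?_
    change ‖signedCoord (g ε z)‖⁻¹ • signedCoord (g ε z) = z.1
    have : signedCoord (g ε z) = (∑ i, |z.1 i|)⁻¹ • z.1 := signedCoord_ofSigned ε (hz0 z)
    have hN := sum_abs_pos (hz0 z)
    rw [this, norm_smul, norm_eq_of_mem_sphere, mul_one, Real.norm_of_nonneg (inv_nonneg.2 hN.le),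
      inv_inv, smul_smul, mul_inv_cancel₀ hN.ne', one_smul]
  have hgk : ∀ ε, ∀ x ∈ orthant ε, g ε (k x) = x := fun ε x hx => by
    refine Subtype.ext ?_
    change ofSigned ε (‖signedCoord x‖⁻¹ • signedCoord x) = x.1
    rw [ofSigned_smul _ (inv_pos.2 (norm_pos_iff.2 (hy0 x))), ofSigned_signedCoord hx]
  have hkneg : ∀ ε ε' x, x ∈ orthant ε → x ∈ orthant ε' → ∀ i, ε i ≠ ε' i → (k x).1 i ≤ 0 := by
    intro ε ε' x hx hx' i hi
    change ‖signedCoord x‖⁻¹ * signedCoord x i ≤ 0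
    refine mul_nonpos_of_nonneg_of_nonpos (inv_nonneg.2 (norm_nonneg _)) ?_
    rw [signedCoord_apply hx, hx' i _ hi, zero_sub]
    exact neg_nonpos.2 (x.2.1.1 _)
  -- On an overlap of two orthants, every coordinate where the choices differ is nonpositive, and
  -- the flow keeps it so. Hence the flow lifts to the whole complex.
  have hgcongr : ∀ ε ε' x, x ∈ orthant ε → x ∈ orthant ε' → ∀ t,
      g ε (h (t, k x)) = g ε' (h (t, k x)) := by
    intro ε ε' x hx hx' t
    exact Subtype.ext (ofSigned_congr fun i hi => hneg _ _ _ (hkneg ε ε' x hx hx' i hi))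
  have hgb : ∀ ε ε', g ε b = g ε' b := fun ε ε' =>
    Subtype.ext (ofSigned_congr fun i _ => (hb i).le)
  let inc : (∀ i, Fin (s i)) → Metric.sphere (0 : EuclideanSpace ℝ ι) 1 →
      Wedge fun _ : (∀ i, Fin (s i)) => b := fun ε z => Quot.mk _ (.inr ⟨ε, z⟩)
  have hinc : ∀ ε, Continuous (inc ε) := fun ε =>
    continuous_quot_mk.comp (continuous_inr.comp continuous_sigmaMk)
  have hincb : ∀ ε, inc ε b = Quot.mk _ (.inl ()) := fun ε =>
    (Quot.sound (WedgeRel.glue ε)).symm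
  -- If the choices differ, some coordinate is nonpositive and the flow has reached `b`, which is
  -- the wedge point in every summand.
  have hf : ∀ ε, ∀ x ∈ orthant ε, inc (sel x) (h (1, k x)) = inc ε (h (1, k x)) := by
    intro ε x hx
    by_cases he : sel x = ε
    · rw [he]
    · obtain ⟨i, hi⟩ := Function.ne_iff.1 he
      rw [h1 (k x) ⟨i, hkneg _ _ x (hsel x) hx i hi⟩, hincb, hincb]
  have hcover : ⋃ ε, orthant (s := s) ε = Set.univ :=
    Set.eq_univ_of_forall fun x => Set.mem_iUnion.2 ⟨sel x, hsel x⟩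
  let f : C((cliques s).realization, Wedge fun _ : (∀ i, Fin (s i)) => b) :=
    ⟨fun x => inc (sel x) (h (1, k x)), by
      refine (locallyFinite_of_finite orthant).continuous hcover isClosed_orthant fun ε => ?_
      refine ContinuousOn.congr (f := fun x => inc ε (h (1, k x))) ?_ (hf ε)
      exact ((hinc ε).comp (by fun_prop)).continuousOn⟩
  -- The index used for the extra point is immaterial: `b` has negative coordinates, so all `g ε b`
  -- coincide.
  let G : C(Wedge fun _ : (∀ i, Fin (s i)) => b, (cliques s).realization) :=
    ⟨Quot.lift (Sum.elim (fun _ => g (fun i => ⟨0, hs i⟩) b) fun a => g a.1 a.2) (by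
      rintro _ _ ⟨ε⟩; exact hgb _ _), continuous_quot_lift _ <| continuous_const.sumElim <|
      continuous_sigma fun ε => (g ε).continuous⟩
  -- Both composites are the time-one flow, on the complex and on each summand of the wedge; the
  -- flow itself provides the homotopies to the identity.
  refine ⟨⟨f, G, ?_, ?_⟩⟩
  · refine .symm ⟨⟨⟨fun p => g (sel p.2) (h (p.1, k p.2)), ?_⟩, fun x => ?_, fun x => ?_⟩⟩
    · refine (locallyFinite_of_finite fun ε =>
        (Prod.snd ⁻¹' orthant ε : Set (unitInterval × (cliques s).realization))).continuous ?_
        (fun ε => (isClosed_orthant ε).preimage continuous_snd) fun ε => ?_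
      · rw [← Set.preimage_iUnion, hcover, Set.preimage_univ]
      · refine ContinuousOn.congr (f := fun p => g ε (h (p.1, k p.2))) ?_
          fun p hp => hgcongr _ _ p.2 (hsel p.2) hp p.1
        fun_prop
    · change g (sel x) (h (0, k x)) = x
      rw [h0, hgk _ _ (hsel x)]
    · rfl
  · let F : C(Wedge fun _ : (∀ i, Fin (s i)) => b,
        C(unitInterval, Wedge fun _ : (∀ i, Fin (s i)) => b)) :=
      ⟨Quot.lift (Sum.elim (fun _ => ContinuousMap.const _ (Quot.mk _ (.inl ()))) fun a =>
          (⟨fun t => inc a.1 (h (t, a.2)), (hinc a.1).comp (by fun_prop)⟩ : C(unitInterval, _))) (by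
        rintro _ _ ⟨ε⟩
        ext t
        change _ = inc ε (h (t, b))
        rw [hhb, hincb]; rfl), by
        refine continuous_quot_lift _ <| continuous_const.sumElim <| continuous_sigma fun ε => ?_
        exact ContinuousMap.continuous_of_continuous_uncurry _
          ((hinc ε).comp (f := fun p : Metric.sphere (0 : EuclideanSpace ℝ ι) 1 × unitInterval =>
            h (p.2, p.1)) (by fun_prop))⟩
    refine .symm ⟨⟨⟨fun p => F p.2 p.1, ?_⟩, fun w => ?_, fun w => ?_⟩⟩
    · exact (F.uncurry.continuous).comp continuous_swap
    · obtain ⟨_ | ⟨ε, z⟩⟩ := w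
      · rfl
      · change inc ε (h (0, z)) = inc ε z
        rw [h0]
    · obtain ⟨_ | ⟨ε, z⟩⟩ := w
      · change Quot.mk _ (.inl ()) = inc (sel (g _ b)) (h (1, k (g _ b)))
        rw [hkg, hhb, hincb]
      · change inc ε (h (1, z)) = inc (sel (g ε z)) (h (1, k (g ε z)))
        rw [hf ε _ (hg ε z), hkg]

end

/-! ### From clique types to the theorem -/

theorem HasCliqueType.nonempty_homotopyEquiv {A : LoopGraph} {m p : ℕ} (h : A.HasCliqueType m p)
    (hm : 1 ≤ m) (hp : p ≠ 0) :
    Nonempty (ContinuousMap.HomotopyEquiv A.realization (WedgeOfSpheres p (m - 1))) := by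
  classical
  obtain ⟨-, ι, _, s, rfl, rfl, hA⟩ := h
  have : Nonempty ι := Fintype.card_pos_iff.1 hm
  have hs : ∀ i, 0 < s i := fun i =>
    Nat.pos_of_ne_zero fun hi => hp (Finset.prod_eq_zero (Finset.mem_univ i) hi)
  let v : EuclideanSpace ℝ ι := WithLp.toLp 2 fun _ => -1
  have hv : v ≠ 0 := fun hv => by
    have := congrFun (congrArg WithLp.ofLp hv) (Classical.arbitrary ι)
    simp [v] at this
  let b : Metric.sphere (0 : EuclideanSpace ℝ ι) 1 := ⟨‖v‖⁻¹ • v, by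
    rw [mem_sphere_zero_iff_norm, norm_smul, norm_inv, norm_norm,
      inv_mul_cancel₀ (norm_ne_zero_iff.2 hv)]⟩
  have hb : ∀ i, b.1 i < 0 := fun i => by
    change ‖v‖⁻¹ * (-1) < 0
    have := inv_pos.2 (norm_pos_iff.2 hv)
    linarith
  obtain ⟨φ, hφ⟩ := nonempty_sphere_homeomorph (d := Fintype.card ι - 1)
    (Nat.sub_add_cancel hm).symm b
  have e : (∀ i, Fin (s i)) ≃ Fin (∏ i, s i) := Fintype.equivFinOfCardEq (by simp)
  obtain ⟨ψ⟩ := Wedge.nonempty_homeomorph e φ hφ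
  obtain ⟨e₁⟩ := hA.nonempty_homotopyEquiv
  obtain ⟨e₂⟩ := nonempty_homotopyEquiv_cliques hs b hb
  exact ⟨e₁.trans (e₂.trans ψ.toHomotopyEquiv)⟩

theorem hasCliqueType_cylRect {M N m p q : ℕ} (hM : 1 ≤ M) (hM2 : M % 2 = 0)
    (h : (cycle M).HasCliqueType m p) (hN : N + 1 = 3 * q ∨ N = 3 * q) (hq : 1 ≤ q) :
    (ofSimpleGraph (cylRect M N)).HasCliqueType (m * q) (p ^ q) := by
  refine HasCliqueType.of_eqv ?_ (eqv_cylRect hM hM2)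
  obtain ⟨q, rfl⟩ := Nat.exists_eq_add_of_le' hq
  rcases hN with hN | rfl
  · obtain rfl : N = 3 * q + 2 := by omega
    exact (hasCliqueType_cylinder hM2 h q).2
  · exact (hasCliqueType_cylinder hM2 h (q + 1)).1

end LoopGraph

end HardParticle

open HardParticle HardParticle.LoopGraph in
theorem mainTheorem2 (M N : ℕ) (hM : 1 ≤ M) (hN : 1 ≤ N) (hMeven : Even M)
    (m n : ℕ) (hm : m = ⌊((M : ℚ) + 1) / 3⌋₊) (hn : n = ⌈(N : ℚ) / 3⌉₊) :
    (N ≡ 1 [MOD 3] →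
      ContractibleSpace
        (HardParticle.realization (HardParticle.independenceComplex (HardParticle.cylRect M N))) ∧
      HardParticle.partitionFunction (HardParticle.cylRect M N) (-1) = 0) ∧
    (¬ N ≡ 1 [MOD 3] →
      (M ≡ 0 [MOD 3] →
        Nonempty (ContinuousMap.HomotopyEquiv
          (HardParticle.realization (HardParticle.independenceComplex (HardParticle.cylRect M N)))
          (HardParticle.WedgeOfSpheres (2 ^ n) (m * n - 1))) ∧
        HardParticle.partitionFunction (HardParticle.cylRect M N) (-1) = 2 ^ n) ∧
      (M ≡ 1 [MOD 3] ∨ M ≡ 2 [MOD 3] →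
        Nonempty (ContinuousMap.HomotopyEquiv
          (HardParticle.realization (HardParticle.independenceComplex (HardParticle.cylRect M N)))
          (HardParticle.Sphere (m * n - 1))) ∧
        HardParticle.partitionFunction (HardParticle.cylRect M N) (-1) = (-1) ^ n)) := by
  have hM2 : M % 2 = 0 := Nat.even_iff.1 hMeven
  have hm' : m = (M + 1) / 3 := by
    rw [hm, show ((M : ℚ) + 1) / 3 = ((M + 1 : ℕ) : ℚ) / (3 : ℕ) by push_cast; ring,
      Nat.floor_div_eq_div]
  have hn1 : N ≤ 3 * n := by
    have := Nat.le_ceil ((N : ℚ) / 3)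
    rw [← hn, div_le_iff₀ (by norm_num)] at this
    have h' : (N : ℚ) ≤ (3 * n : ℕ) := by push_cast; linarith
    exact_mod_cast h'
  have hn2 : 3 * n < N + 3 := by
    have := Nat.ceil_lt_add_one (a := (N : ℚ) / 3) (by positivity)
    rw [← hn] at this
    have h' : ((3 * n : ℕ) : ℚ) < (N + 3 : ℕ) := by push_cast; linarith
    exact_mod_cast h'
  rw [realization_independenceComplex, partitionFunction_neg_one]
  simp only [Nat.ModEq]
  refine ⟨fun hN1 => ?_, fun hN1 => ⟨fun hM3 => ?_, fun hM3 => ?_⟩⟩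
  · obtain ⟨q, rfl⟩ : ∃ q, N = 3 * q + 1 := ⟨N / 3, by omega⟩
    obtain ⟨B, w, hB, hw⟩ := exists_isolated_cylinder hM2 hM q
    have hE := (eqv_cylRect hM hM2).trans hB
    obtain ⟨e⟩ := hE.nonempty_homotopyEquiv
    have := contractibleSpace_of_isolated w hw
    exact ⟨e.contractibleSpace, hE.altCount_eq.trans (altCount_eq_zero_of_isolated w hw)⟩
  · have hc : (cycle M).HasCliqueType m 2 := by
      obtain ⟨k, rfl⟩ : ∃ k, M = 3 * k + 3 := ⟨M / 3 - 1, by omega⟩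
      rw [show m = k + 1 by omega]
      exact hasCliqueType_cycle_add (by norm_num) hasCliqueType_cycle_three k
    have h := hasCliqueType_cylRect (N := N) (q := n) hM hM2 hc (by omega) (by omega)
    refine ⟨h.nonempty_homotopyEquiv (Nat.mul_pos (by omega) (by omega)) (by positivity), ?_⟩
    -- Here `M` is a multiple of `6`, so `m = M / 3` is even and the sign disappears.
    rw [h.1, Even.neg_one_pow (Even.mul_right (Nat.even_iff.2 (by omega)) n)]
    simp
  · have hc : (cycle M).HasCliqueType m 1 := by
      rcases hM3 with hM3 | hM3
      · obtain ⟨k, rfl⟩ : ∃ k, M = 3 * k + 4 := ⟨M / 3 - 1, by omega⟩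
        rw [show m = k + 1 by omega]
        exact hasCliqueType_cycle_add (by norm_num)
          (hasCliqueType_cycle_two.of_eqv eqv_cycle_four) k
      · obtain ⟨k, rfl⟩ : ∃ k, M = 3 * k + 2 := ⟨M / 3, by omega⟩
        rw [show m = k + 1 by omega]
        exact hasCliqueType_cycle_add le_rfl hasCliqueType_cycle_two k
    have h := hasCliqueType_cylRect (N := N) (q := n) hM hM2 hc (by omega) (by omega)
    rw [one_pow] at h
    obtain ⟨e⟩ := h.nonempty_homotopyEquiv (Nat.mul_pos (by omega) (by omega)) one_ne_zero
    obtain ⟨φ⟩ := Wedge.nonempty_homeomorph_of_unique (ι := Fin 1) (Sphere.base (m * n - 1))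
    refine ⟨⟨e.trans φ.toHomotopyEquiv⟩, ?_⟩
    -- Here `M` is `2` or `4` mod `6`, so `m` is odd and the sign is `(-1) ^ n`.
    rw [h.1, pow_mul, Odd.neg_one_pow (Nat.odd_iff.2 (by omega : m % 2 = 1))]
    simp
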